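/- **Transport theorem.** Let $d\ge 1$, $T>0$ and let $(\Omega(t))_{t\in(0,T)}$ be a moving domain in $\mathbb R^d$, i.e. a family of subsets of $\mathbb R^d$ such that: - for each $t\in(0,T)$, $\Omega(t)$ is a bounded open set with Lipschitz boundary; - the space-time domain $\Omega_T=\{(t,x): t\in(0,T),\ x\in\Omega(t)\}$ is a bounded open set with Lipschitz boundary in $\mathbb R^{d+1}$; - at $\mathcal H^{d}$-a.e. point $(t,x)$ of the lateral boundary $\partial_x\Omega_T=\{(t,x): t\in(0,T),\ x\in\partial\Omega(t)\}$ there is an outer normal to $\Omega_T$ of the form $\tilde n(t,x)=(-\tilde n_t(t,x),\,n(t,x))\in\mathbb R\times\mathbb R^d$, where $n(t,\cdot)$ is the outer unit normal of $\Omega(t)$. The number $\tilde n_t(t,x)$, which is uniquely determined, is called the normal velocity. Let $u\in C^1(\overline{\Omega_T})$, that is, $u$ is real-valued and $C^1$ in $\Omega_T$, and $u$ and its first derivatives extend continuously to $\overline{\Omega_T}$. Then for almost every $t\in(0,T)$ the function $s\mapsto\int_{\Omega(s)}u(s,x)\,dx$ is differentiable at $t$, the integrals below converge absolutely, and $$\frac{d}{dt}\int_{\Omega(t)}u(t,x)\,dx=\int_{\Omega(t)}\partial_t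 u(t,x)\,dx+\int_{\partial\Omega(t)}u(t,x)\,\tilde n_t(t,x)\,d\mathcal H^{d-1}(x),$$ where $\mathcal H^{d-1}$ is the $(d-1)$-dimensional Hausdorff measure (normalized so as to give surface area). -/

import Mathlib

open Set Filter Topology MeasureTheory
open scoped NNReal

/-- Space `ℝ^d`, with the Euclidean norm. -/
abbrev Space (d : ℕ) : Type := EuclideanSpace ℝ (Fin d)

/-- Space-time `ℝ × ℝ^d = ℝ^{d+1}`, with the Euclidean norm. -/
abbrev SpaceTime (d : ℕ) : Type := WithLp 2 (ℝ × Space d)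

/-- The space-time point (or vector) with time component `t` and spatial component `x`. -/
def stPoint {d : ℕ} (t : ℝ) (x : Space d) : SpaceTime d := WithLp.toLp 2 (t, x)

/-- A bounded open set `G` whose boundary is Lipschitz: near every boundary point `p` there are a
unit direction `e` and a Lipschitz function `g` of the component orthogonal to `e` such that `G` is,
in a ball around `p`, the strict subgraph of `g` in direction `e`.
Neither connectedness nor non-emptiness is required. -/
structure IsLipschitzDomain {F : Type*} [NormedAddCommGroup F] [InnerProductSpace ℝ F]
    (G : Set F) : Prop where
  isOpen : IsOpen G
  isBounded : Bornology.IsBounded G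
  graph : ∀ p ∈ frontier G, ∃ (e : F) (K : ℝ≥0) (g : F → ℝ) (r : ℝ),
    ‖e‖ = 1 ∧ LipschitzWith K g ∧ 0 < r ∧
      ∀ y ∈ Metric.ball p r, (y ∈ G ↔ inner ℝ e y < g (y - inner ℝ e y • e))

/-- `ν` is a (not necessarily unit) outer normal to `G` at `p`: it is nonzero and to first order at
`p` the set `G` is the half-space `⟪y - p, ν⟫ < 0`. For a Lipschitz domain this says that the
function whose graph is the boundary is differentiable at the point, and that `ν` is a positive
multiple of the outer unit normal given by its gradient. -/
def IsOuterNormal {F : Type*} [NormedAddCommGroup F] [InnerProductSpace ℝ F]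
    (G : Set F) (p ν : F) : Prop :=
  p ∈ frontier G ∧ ν ≠ 0 ∧ ∀ ε > (0 : ℝ), ∀ᶠ y in 𝓝 p,
    (inner ℝ (y - p) ν < -(ε * ‖y - p‖) → y ∈ G) ∧ (ε * ‖y - p‖ < inner ℝ (y - p) ν → y ∉ G)

/-- The space-time domain `Ω_T`. -/
def spaceTimeDomain {d : ℕ} (T : ℝ) (Ω : ℝ → Set (Space d)) : Set (SpaceTime d) :=
  {p | p.fst ∈ Ioo 0 T ∧ p.snd ∈ Ω p.fst}

/-- The lateral boundary `∂ₓ Ω_T`. -/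
def lateralBoundary {d : ℕ} (T : ℝ) (Ω : ℝ → Set (Space d)) : Set (SpaceTime d) :=
  {p | p.fst ∈ Ioo 0 T ∧ p.snd ∈ frontier (Ω p.fst)}

/-- `v` is the normal velocity of the moving set `Ω` at the point `(t, x)`: with `n` the outer unit
normal to `Ω t` at `x`, the vector `(-v, n)` is an outer normal to `Ω_T` at `(t, x)`. -/
def IsNormalVelocityAt {d : ℕ} (T : ℝ) (Ω : ℝ → Set (Space d)) (t : ℝ) (x : Space d) (v : ℝ) :
    Prop :=
  ∃ n : Space d, ‖n‖ = 1 ∧ IsOuterNormal (Ω t) x n ∧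
    IsOuterNormal (spaceTimeDomain T Ω) (stPoint t x) (stPoint (-v) n)

open Classical in
/-- The normal velocity, where it exists (it is then unique), and `0` elsewhere. -/
noncomputable def normalVelocity {d : ℕ} (T : ℝ) (Ω : ℝ → Set (Space d)) (t : ℝ) (x : Space d) :
    ℝ :=
  if h : ∃ v, IsNormalVelocityAt T Ω t x v then h.choose else 0

/-- A moving domain: each `Ω t`, `0 < t < T`, and the space-time domain `Ω_T` are Lipschitz, and
at `ℋ^d`-almost every point of the lateral boundary the normal to `Ω_T` is of the form `(-v, n)`
with `n` the outer unit normal of the time slice. -/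
structure IsMovingDomain {d : ℕ} (T : ℝ) (Ω : ℝ → Set (Space d)) : Prop where
  slice : ∀ t ∈ Ioo 0 T, IsLipschitzDomain (Ω t)
  spaceTime : IsLipschitzDomain (spaceTimeDomain T Ω)
  normal : ∀ᵐ p ∂(Measure.euclideanHausdorffMeasure d : Measure (SpaceTime d)),
    p ∈ lateralBoundary T Ω → ∃ v, IsNormalVelocityAt T Ω p.fst p.snd v

/-- `u` is of class `C¹` up to the boundary of the open set `G`: it is `C¹` in `G`, and `u` and
its derivative are continuous up to the boundary (the values of `u` on `∂G` being those of the
continuous extension). -/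
def IsC1UpToBoundary {F : Type*} [NormedAddCommGroup F] [NormedSpace ℝ F] (G : Set F) (u : F → ℝ) :
    Prop :=
  ContDiffOn ℝ 1 u G ∧ ContinuousOn u (closure G) ∧
    ∃ D : F → F →L[ℝ] ℝ, ContinuousOn D (closure G) ∧ ∀ p ∈ G, D p = fderiv ℝ u p

/-- Outer normals at a point are unique up to a positive factor. -/
theorem IsOuterNormal.unique {F : Type*} [NormedAddCommGroup F] [InnerProductSpace ℝ F]
    {G : Set F} {p a b : F} (ha : IsOuterNormal G p a) (hb : IsOuterNormal G p b) :
    ‖b‖ • a = ‖a‖ • b := by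
  obtain ⟨-, ha0, ha⟩ := ha
  obtain ⟨-, hb0, hb⟩ := hb
  by_contra hne
  have hab : inner ℝ a b < ‖a‖ * ‖b‖ := inner_lt_norm_mul_iff_real.2 hne
  have na : 0 < ‖a‖ := norm_pos_iff.2 ha0
  have nb : 0 < ‖b‖ := norm_pos_iff.2 hb0
  set w : F := ‖b‖ • a - ‖a‖ • b with hw
  have hwa : inner ℝ w a = ‖a‖ * (‖a‖ * ‖b‖ - inner ℝ a b) := by
    rw [hw, inner_sub_left, real_inner_smul_left, real_inner_smul_left,
      real_inner_self_eq_norm_sq, real_inner_comm a b]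
    ring
  have hwb : inner ℝ w b = -(‖b‖ * (‖a‖ * ‖b‖ - inner ℝ a b)) := by
    rw [hw, inner_sub_left, real_inner_smul_left, real_inner_smul_left,
      real_inner_self_eq_norm_sq]
    ring
  have hδ : 0 < ‖a‖ * ‖b‖ - inner ℝ a b := sub_pos.2 hab
  have hw0 : 0 < ‖w‖ := norm_pos_iff.2 (sub_ne_zero.2 hne)
  have key : ∀ c : ℝ, 0 < c → ∃ ε > (0 : ℝ), ε * ‖w‖ < c := fun c hc =>
    ⟨c / (2 * ‖w‖), by positivity, by field_simp; linarith⟩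
  obtain ⟨ε, hε, hεa⟩ := key _ (mul_pos na hδ)
  obtain ⟨ε', hε', hεb⟩ := key _ (mul_pos nb hδ)
  have hlim : Tendsto (fun s : ℝ => p + s • w) (𝓝[>] 0) (𝓝 p) := by
    have : Continuous (fun s : ℝ => p + s • w) := by fun_prop
    simpa using (this.tendsto 0).mono_left nhdsWithin_le_nhds
  obtain ⟨s, ⟨h1, h2⟩, hs⟩ := (((hlim.eventually (ha ε hε)).and
    (hlim.eventually (hb ε' hε'))).and self_mem_nhdsWithin).exists
  have hs : (0 : ℝ) < s := hs
  have hsw : ‖p + s • w - p‖ = s * ‖w‖ := by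
    rw [add_sub_cancel_left, norm_smul, Real.norm_of_nonneg hs.le]
  refine h1.2 ?_ (h2.1 ?_)
  · rw [hsw, add_sub_cancel_left, real_inner_smul_left, hwa]
    nlinarith
  · rw [hsw, add_sub_cancel_left, real_inner_smul_left, hwb]
    nlinarith

/-- The normal velocity at a point is unique. -/
theorem IsNormalVelocityAt.unique {d : ℕ} {T : ℝ} {Ω : ℝ → Set (Space d)} {t : ℝ} {x : Space d}
    {v w : ℝ} (hv : IsNormalVelocityAt T Ω t x v) (hw : IsNormalVelocityAt T Ω t x w) : v = w := by
  obtain ⟨n, hn, -, h1⟩ := hv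
  obtain ⟨m, hm, -, h2⟩ := hw
  have h := h1.unique h2
  have hpos : 0 < ‖stPoint (-w) m‖ := norm_pos_iff.2 h2.2.1
  have hs : ‖stPoint (-w) m‖ • n = ‖stPoint (-v) n‖ • m := congrArg (fun p => p.snd) h
  have hf : ‖stPoint (-w) m‖ * (-v) = ‖stPoint (-v) n‖ * (-w) := congrArg (fun p => p.fst) h
  have hnorm := congrArg norm hs
  rw [norm_smul, norm_smul, hn, hm, norm_norm, norm_norm, mul_one, mul_one] at hnorm
  rw [← hnorm] at hf
  have := mul_left_cancel₀ hpos.ne' hf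
  linarith

/-!
The proof follows the time lines `τ ↦ (τ, x)`. Write `G` for the space-time domain and extend `u` by
zero off `G`. Along almost every time line, `u` is `C¹` on an open subset of the line, so by the
fundamental theorem of calculus its increment over `[a, b]` is the integral of `∂ₜu` plus the sum of
the jumps at the boundary points of this open set. Integrated over `x`, the increments give the
increment of `∫_{Ω t} u`, and Fubini's theorem handles `∂ₜu`; the jumps must give the boundary
integral.

The boundary points of `G` on time lines are of three kinds.

* Points over the *jump times*, where `∂G` has points outside `∂Ω(t)`. Such a point is a local
  extremum of the time on `∂G` (`IsLipschitzDomain.isLocalExtrOn_time`), so there are only countably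
  many jump times (`IsLipschitzDomain.countable_jumpTimes`). The volumes of the jumps have a finite
  sum, and their contribution is bounded by an atomic finite measure on the time axis, `jumpMeasure`,
  whose density with respect to Lebesgue measure vanishes almost everywhere.
* Points without normal, or with normal velocity zero. They project to a null set in space
  (`IsMovingDomain.volume_snd_image_not_moving`): the former because they form an `ℋ^d`-null set, the
  latter by Sard's argument in a Lipschitz chart, using Rademacher's theorem.
* The rest, `movingBoundary`. Near such a point `∂G` satisfies a cone condition over space, so this
  set is, up to an `ℋ^d`-null set, a countable disjoint union of graphs `t = f i x`, `x ∈ s i`, with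
  `‖f' i‖ = 1 / |v i|` for the normal velocity `v i`
  (`IsMovingDomain.exists_isGraphDecomposition`). At such a point the time line crosses `∂G` and the
  jump is `u` times the sign of `v i`.

The time slices of a graph are the level sets of `f i`, and the coarea formula
(`measurable_and_lintegral_hausdorff_level`) turns the integral over `x ∈ s i` of the signed jumps
into the integral over time of `∫ u v dℋ^{d-1}` over the slices
(`IsGraphDecomposition.integral_velocity_eq_integral_crossingSum`). The coarea formula is proved by
cutting the set into pieces on which the function is close to a linear form; an almost isometric
change of variables then reduces it to slicing by hyperplanes.

Altogether, the increment of `∫_{Ω t} u` over `[a, b]` is the integral over `[a, b]` of the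
right-hand side of the transport formula, up to an error at most a multiple of the jump measure of
`[a, b]` (`abs_integral_increment_sub_le`). Lebesgue's differentiation theorem and the singularity
of the jump measure give the derivative at almost every time
(`ae_hasDerivAt_of_abs_increment_sub_le`). Finally, the part of `∂Ω(t)` with nonzero velocity outside
the graphs is `ℋ^{d-1}`-null for almost every `t`, by Eilenberg's inequality for null sets
(`ae_hausdorffMeasure_level_eq_zero`).
-/

/-! ### The coarea formula for differentiable real functions -/

theorem LipschitzOnWith.euclideanHausdorffMeasure_image_le {X Y : Type*} [EMetricSpace X]
    [EMetricSpace Y] [MeasurableSpace X] [BorelSpace X] [MeasurableSpace Y] [BorelSpace Y]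
    {K : ℝ≥0} {f : X → Y} {s : Set X} (h : LipschitzOnWith K f s) (d : ℕ) :
    μHE[d] (f '' s) ≤ (K : ENNReal) ^ d * μHE[d] s := by
  have := h.hausdorffMeasure_image_le (d := d) (by positivity)
  simp_rw [Measure.euclideanHausdorffMeasure_def, Measure.smul_apply, ENNReal.smul_def, smul_eq_mul]
  rw [ENNReal.rpow_natCast] at this
  rw [mul_left_comm]
  gcongr

/-- Comparison of the Hausdorff measures of a set and of its image under an almost isometric map. -/
theorem euclideanHausdorffMeasure_image_le_of_almost_isometry {E : Type*} [NormedAddCommGroup E]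
    [MeasurableSpace E] [BorelSpace E] {c : ℝ≥0} {Φ : E → E} {s : Set E}
    (h₁ : ∀ x ∈ s, ∀ y ∈ s, dist (Φ x) (Φ y) ≤ c * dist x y)
    (h₂ : ∀ x ∈ s, ∀ y ∈ s, dist x y ≤ c * dist (Φ x) (Φ y)) (k : ℕ) :
    μHE[k] (Φ '' s) ≤ (c : ENNReal) ^ k * μHE[k] s ∧
      μHE[k] s ≤ (c : ENNReal) ^ k * μHE[k] (Φ '' s) := by
  refine ⟨(LipschitzOnWith.of_dist_le_mul h₁).euclideanHausdorffMeasure_image_le k, ?_⟩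
  have hinj : InjOn Φ s := fun x hx y hy hxy => by
    have := h₂ x hx y hy
    rw [hxy, dist_self, mul_zero] at this
    exact dist_le_zero.1 this
  have hL : LipschitzOnWith c (Function.invFunOn Φ s) (Φ '' s) := by
    refine LipschitzOnWith.of_dist_le_mul ?_
    rintro _ ⟨x, hx, rfl⟩ _ ⟨y, hy, rfl⟩
    rw [hinj.leftInvOn_invFunOn hx, hinj.leftInvOn_invFunOn hy]
    exact h₂ x hx y hy
  have := hL.euclideanHausdorffMeasure_image_le k
  rwa [hinj.leftInvOn_invFunOn.image_image] at this

section Coarea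

variable {V : Type*} [NormedAddCommGroup V] [InnerProductSpace ℝ V] [MeasurableSpace V]
  [BorelSpace V] [FiniteDimensional ℝ V]

/-- Fubini's theorem for the slices of a set by the hyperplanes orthogonal to a unit vector, with
the measurability of the areas of the slices. -/
theorem measurable_and_lintegral_hausdorff_hyperplane_slice {e : V} (he : ‖e‖ = 1) {t : Set V}
    (ht : MeasurableSet t) :
    Measurable (fun a : ℝ => μHE[Module.finrank ℝ V - 1] (t ∩ {x | inner ℝ e x = a})) ∧
      ∫⁻ a : ℝ, μHE[Module.finrank ℝ V - 1] (t ∩ {x | inner ℝ e x = a}) = volume t := by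
  have he0 : e ≠ 0 := by rintro rfl; simp at he
  have hslice : ∀ a : ℝ, (t ∩ {x | inner ℝ e x = a}) =
      t ∩ (AffineSubspace.mk' (a • e +ᵥ (0 : V)) (ℝ ∙ e)ᗮ : Set V) := by
    intro a
    ext x
    simp only [mem_inter_iff, mem_ofPred_eq, and_congr_right_iff, SetLike.mem_coe,
      AffineSubspace.mem_mk', Submodule.mem_orthogonal_singleton_iff_inner_right]
    intro _
    simp [inner_sub_right, real_inner_smul_right, he, sub_eq_zero]
  constructor
  · have hfr : Module.finrank ℝ (ℝ ∙ e)ᗮ = Module.finrank ℝ V - 1 := by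
      rw [← (ℝ ∙ e).finrank_add_finrank_orthogonal, finrank_span_singleton he0]
      omega
    let A : Set (ℝ × (ℝ ∙ e)ᗮ) := {q | q.1 • e + (q.2 : V) ∈ t}
    have hA : MeasurableSet A := by
      have : Continuous fun q : ℝ × (ℝ ∙ e)ᗮ => q.1 • e + (q.2 : V) := by fun_prop
      exact this.measurable ht
    have hm := measurable_measure_prodMk_left (ν := (volume : Measure (ℝ ∙ e)ᗮ)) hA
    convert hm using 2 with a
    have hiso : Isometry fun z : (ℝ ∙ e)ᗮ => a • e + (z : V) :=
      Isometry.of_dist_eq fun x y => by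
        rw [dist_eq_norm, dist_eq_norm, add_sub_add_left_eq_sub]; rfl
    rw [← InnerProductSpace.euclideanHausdorffMeasure_eq_volume, hfr,
      ← hiso.euclideanHausdorffMeasure_image]
    congr 1
    ext x
    simp only [mem_inter_iff, mem_ofPred_eq, mem_image, mem_preimage, A]
    constructor
    · rintro ⟨hx, hxa⟩
      refine ⟨⟨x - a • e, ?_⟩, by simpa using hx, by simp⟩
      rw [Submodule.mem_orthogonal_singleton_iff_inner_right]
      simp [inner_sub_right, real_inner_smul_right, he, hxa]
    · rintro ⟨z, hz, rfl⟩
      refine ⟨hz, ?_⟩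
      have := (Submodule.mem_orthogonal_singleton_iff_inner_right).1 z.2
      simp [inner_add_right, real_inner_smul_right, he, this]
  · rw [← InnerProductSpace.euclideanHausdorffMeasure_eq_volume (V := V),
      EuclideanGeometry.euclideanHausdorffMeasure_eq_lintegral (0 : V) he0 ht]
    simp only [hslice]
    have : ‖e‖ₑ = 1 := by rw [← ofReal_norm, he, ENNReal.ofReal_one]
    rw [this, one_mul]

/-- The coarea formula, up to powers of `c`, on a set where `f` is close to a linear form. The map
`x ↦ x + (f x - A x) / ‖A‖ • e`, where `e` is the unit gradient of `A`, is almost an isometry and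
takes the level sets of `f` to hyperplane slices. -/
theorem exists_measurable_approx_hausdorff_level_of_approx {s : Set V} (hs : MeasurableSet s)
    {f : V → ℝ} {A : V →L[ℝ] ℝ} (hA : A ≠ 0) {c : ℝ≥0} (hc : 1 < c)
    (hf : ApproximatesLinearOn f A s ((1 - c⁻¹) * ‖A‖₊)) :
    ∃ g : ℝ → ENNReal, Measurable g ∧
      (∀ t, g t ≤ c ^ (Module.finrank ℝ V - 1) *
        μHE[Module.finrank ℝ V - 1] (s ∩ f ⁻¹' {t})) ∧
      (∀ t, μHE[Module.finrank ℝ V - 1] (s ∩ f ⁻¹' {t}) ≤ c ^ (Module.finrank ℝ V - 1) * g t) ∧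
      ∫⁻ t, g t ≤ c ^ Module.finrank ℝ V * (‖A‖ₑ * volume s) ∧
      ‖A‖ₑ * volume s ≤ c ^ Module.finrank ℝ V * ∫⁻ t, g t := by
  have nA : 0 < ‖A‖ := norm_pos_iff.2 hA
  have c0 : (0 : ℝ) < c := zero_lt_one.trans (by exact_mod_cast hc)
  have c1 : (1 : ℝ) < c := by exact_mod_cast hc
  set ε : ℝ := 1 - (c : ℝ)⁻¹ with hε
  have hcinv : (c : ℝ)⁻¹ < 1 := inv_lt_one_of_one_lt₀ c1
  have hεc : ((1 - c⁻¹ : ℝ≥0) : ℝ) = ε := by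
    rw [NNReal.coe_sub (by exact_mod_cast hcinv.le)]; simp [hε]
  have hf' : ∀ x ∈ s, ∀ y ∈ s, |f x - f y - A (x - y)| ≤ ε * ‖A‖ * ‖x - y‖ := by
    intro x hx y hy
    have := hf x hx y hy
    rw [NNReal.coe_mul, hεc] at this
    simpa using this
  set w : V := (InnerProductSpace.toDual ℝ V).symm A with hw
  have hwA : ∀ x, inner ℝ w x = A x := fun x => by
    rw [hw, InnerProductSpace.toDual_symm_apply]
  have nw : ‖w‖ = ‖A‖ := by rw [hw, LinearIsometryEquiv.norm_map]
  set e : V := ‖A‖⁻¹ • w with he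
  have ne : ‖e‖ = 1 := by
    rw [he, norm_smul, nw, norm_inv, norm_norm, inv_mul_cancel₀ nA.ne']
  have heA : ∀ x, inner ℝ e x = ‖A‖⁻¹ * A x := fun x => by
    rw [he, real_inner_smul_left, hwA]
  set Φ : V → V := fun x => x + (‖A‖⁻¹ * (f x - A x)) • e with hΦ
  have hΦe : ∀ x, inner ℝ e (Φ x) = ‖A‖⁻¹ * f x := fun x => by
    simp only [hΦ]
    rw [inner_add_right, real_inner_smul_right, real_inner_self_eq_norm_sq, ne, heA]
    ring
  have hdiff : ∀ x ∈ s, ∀ y ∈ s, ‖(Φ x - Φ y) - (x - y)‖ ≤ ε * ‖x - y‖ := by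
    intro x hx y hy
    have : (Φ x - Φ y) - (x - y) = (‖A‖⁻¹ * (f x - f y - A (x - y))) • e := by
      simp only [hΦ, map_sub]
      module
    rw [this, norm_smul, ne, mul_one, norm_mul, norm_inv, norm_norm, Real.norm_eq_abs]
    calc ‖A‖⁻¹ * |f x - f y - A (x - y)| ≤ ‖A‖⁻¹ * (ε * ‖A‖ * ‖x - y‖) := by
          gcongr; exact hf' x hx y hy
      _ = ε * ‖x - y‖ := by field_simp
  have h₁ : ∀ x ∈ s, ∀ y ∈ s, dist (Φ x) (Φ y) ≤ c * dist x y := by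
    intro x hx y hy
    rw [dist_eq_norm, dist_eq_norm]
    have h := norm_add_le ((Φ x - Φ y) - (x - y)) (x - y)
    rw [sub_add_cancel] at h
    have h' := hdiff x hx y hy
    have : 1 + ε ≤ c := by
      rw [hε]
      have h3 : (c : ℝ) * (c : ℝ)⁻¹ = 1 := mul_inv_cancel₀ c0.ne'
      nlinarith [sq_nonneg ((c : ℝ) - 1)]
    nlinarith [norm_nonneg (x - y)]
  have h₂ : ∀ x ∈ s, ∀ y ∈ s, dist x y ≤ c * dist (Φ x) (Φ y) := by
    intro x hx y hy
    rw [dist_eq_norm, dist_eq_norm]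
    have h := norm_sub_le (Φ x - Φ y) ((Φ x - Φ y) - (x - y))
    rw [sub_sub_cancel] at h
    have h' := hdiff x hx y hy
    have h4 : (c : ℝ)⁻¹ * ‖x - y‖ ≤ ‖Φ x - Φ y‖ := by rw [hε] at h'; linarith
    calc ‖x - y‖ = c * ((c : ℝ)⁻¹ * ‖x - y‖) := by field_simp
      _ ≤ _ := by gcongr
  have hinj : InjOn Φ s := fun x hx y hy hxy => by
    have := h₂ x hx y hy
    rw [hxy, dist_self, mul_zero] at this
    exact dist_le_zero.1 this
  have hΦs : MeasurableSet (Φ '' s) :=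
    hs.image_of_continuousOn_injOn (LipschitzOnWith.of_dist_le_mul h₁).continuousOn hinj
  obtain ⟨hm, hint⟩ := measurable_and_lintegral_hausdorff_hyperplane_slice ne hΦs
  have himg : ∀ t : ℝ, Φ '' s ∩ {x | inner ℝ e x = ‖A‖⁻¹ * t} = Φ '' (s ∩ f ⁻¹' {t}) := by
    intro t
    rw [← Set.image_inter_preimage]
    congr 1
    ext x
    simp [hΦe, nA.ne']
  have hint' : ∫⁻ t, μHE[Module.finrank ℝ V - 1] (Φ '' s ∩ {x | inner ℝ e x = ‖A‖⁻¹ * t}) =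
      ‖A‖ₑ * volume (Φ '' s) := by
    rw [← hint]
    have h := Real.map_volume_mul_left (inv_ne_zero nA.ne')
    rw [← lintegral_map (μ := volume) hm (measurable_const_mul ‖A‖⁻¹), h, lintegral_smul_measure,
      inv_inv, abs_of_pos nA, ofReal_norm, smul_eq_mul]
  have key := fun (S : Set V) (hS : S ⊆ s) (k : ℕ) =>
    euclideanHausdorffMeasure_image_le_of_almost_isometry (Φ := Φ) (s := S)
      (fun x hx y hy => h₁ x (hS hx) y (hS hy)) (fun x hx y hy => h₂ x (hS hx) y (hS hy)) k
  obtain ⟨k1, k2⟩ := key s subset_rfl (Module.finrank ℝ V)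
  rw [InnerProductSpace.euclideanHausdorffMeasure_eq_volume] at k1 k2
  refine ⟨_, hm.comp (measurable_const_mul ‖A‖⁻¹), fun t => ?_, fun t => ?_, ?_, ?_⟩
  · simp only [Function.comp_apply, himg]
    exact (key _ inter_subset_left _).1
  · simp only [Function.comp_apply, himg]
    exact (key _ inter_subset_left _).2
  · simp only [Function.comp_apply, hint']
    rw [mul_left_comm]
    gcongr
  · simp only [Function.comp_apply, hint']
    rw [mul_left_comm]
    gcongr

/-- The coarea formula up to powers of `c`, obtained by cutting the set into countably many pieces
on which `f` is close to a linear form. -/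
theorem exists_measurable_approx_hausdorff_level {s : Set V} (hs : MeasurableSet s)
    {f : V → ℝ} {f' : V → V →L[ℝ] ℝ} (hf : ∀ x ∈ s, HasFDerivWithinAt f (f' x) s x)
    (h0 : ∀ x ∈ s, f' x ≠ 0) (hm : Measurable f) {c : ℝ≥0} (hc : 1 < c) :
    ∃ g : ℝ → ENNReal, Measurable g ∧
      (∀ t, g t ≤ c ^ (Module.finrank ℝ V - 1) *
        μHE[Module.finrank ℝ V - 1] (s ∩ f ⁻¹' {t})) ∧
      (∀ t, μHE[Module.finrank ℝ V - 1] (s ∩ f ⁻¹' {t}) ≤ c ^ (Module.finrank ℝ V - 1) * g t) ∧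
      ∫⁻ t, g t ≤ c ^ (Module.finrank ℝ V + 1) * ∫⁻ x in s, ‖f' x‖ₑ ∧
      ∫⁻ x in s, ‖f' x‖ₑ ≤ c ^ (Module.finrank ℝ V + 1) * ∫⁻ t, g t := by
  classical
  rcases s.eq_empty_or_nonempty with rfl | hne
  · exact ⟨0, measurable_const, by simp, by simp, by simp, by simp⟩
  have c0 : 0 < c := zero_lt_one.trans hc
  have hcinv : c⁻¹ < 1 := inv_lt_one_of_one_lt₀ hc
  obtain ⟨t, A, tdisj, tmeas, tcov, tA, hA⟩ :=
    exists_partition_approximatesLinearOn_of_hasFDerivWithinAt f s f' hf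
      (fun A => if A = 0 then 1 else (1 - c⁻¹) * ‖A‖₊) (fun A => by
        split_ifs with h
        · exact one_ne_zero
        · exact mul_ne_zero (tsub_pos_of_lt hcinv).ne' (nnnorm_ne_zero_iff.2 h))
  have hA0 : ∀ n, A n ≠ 0 := fun n => by
    obtain ⟨y, hy, h⟩ := hA hne n
    rw [h]; exact h0 y hy
  have tA' : ∀ n, ApproximatesLinearOn f (A n) (s ∩ t n) ((1 - c⁻¹) * ‖A n‖₊) := fun n => by
    simpa [hA0 n] using tA n
  have sm : ∀ n, MeasurableSet (s ∩ t n) := fun n => hs.inter (tmeas n)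
  choose g gm g1 g2 g3 g4 using fun n =>
    exists_measurable_approx_hausdorff_level_of_approx (sm n) (hA0 n) hc (tA' n)
  have hunion : s = ⋃ n, s ∩ t n := by rw [← inter_iUnion, inter_eq_left.2 tcov]
  have hdisj : Pairwise (Function.onFun Disjoint fun n => s ∩ t n) := fun i j hij =>
    (tdisj hij).mono inter_subset_right inter_subset_right
  have hsum : ∀ r, μHE[Module.finrank ℝ V - 1] (s ∩ f ⁻¹' {r}) =
      ∑' n, μHE[Module.finrank ℝ V - 1] (s ∩ t n ∩ f ⁻¹' {r}) := fun r => by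
    conv_lhs => rw [hunion, iUnion_inter]
    exact measure_iUnion (fun i j hij => (hdisj hij).mono inter_subset_left inter_subset_left)
      fun n => (sm n).inter (hm (measurableSet_singleton r))
  have hder : ∀ n, ∀ᵐ x ∂(volume.restrict (s ∩ t n)), ‖f' x - A n‖₊ ≤ (1 - c⁻¹) * ‖A n‖₊ := by
    intro n
    -- The density-point lemma concerns maps of `V` to itself: `f` is composed with an isometric
    -- embedding of the line.
    obtain ⟨y, hy⟩ : ∃ y : V, y ≠ 0 := by
      by_contra! h
      exact hA0 n (by ext x; simp [h x])
    set e : V := ‖y‖⁻¹ • y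
    have ne : ‖e‖ = 1 := norm_smul_inv_norm (𝕜 := ℝ) hy
    have nee : ∀ L : V →L[ℝ] ℝ, ‖L.smulRight e‖₊ = ‖L‖₊ := fun L => by
      ext; simp [ne]
    have := ApproximatesLinearOn.norm_fderiv_sub_le (μ := (volume : Measure V))
      (f := fun x => f x • e) (A := (A n).smulRight e) (δ := (1 - c⁻¹) * ‖A n‖₊) (s := s ∩ t n)
      (fun x hx z hz => by
        have := tA' n x hx z hz
        simpa [← sub_smul, norm_smul, ne] using this) (sm n) (fun x => (f' x).smulRight e)
      (fun x hx => ((hf x hx.1).mono inter_subset_left).smul_const e)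
    filter_upwards [this] with x hx
    rwa [← nee, show (f' x - A n).smulRight e = (f' x).smulRight e - (A n).smulRight e by
      ext; simp [sub_smul]]
  have hreal : ∀ n x, ‖f' x - A n‖₊ ≤ (1 - c⁻¹) * ‖A n‖₊ →
      ‖A n‖ₑ ≤ c * ‖f' x‖ₑ ∧ ‖f' x‖ₑ ≤ c * ‖A n‖ₑ := by
    intro n x hx
    simp only [enorm_eq_nnnorm]
    norm_cast
    rw [← NNReal.coe_le_coe, NNReal.coe_mul, NNReal.coe_sub hcinv.le] at hx
    rw [← NNReal.coe_le_coe, ← NNReal.coe_le_coe]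
    push_cast at hx ⊢
    have c0' : (0 : ℝ) < c := c0
    have h3 : (c : ℝ) * (c : ℝ)⁻¹ = 1 := mul_inv_cancel₀ c0'.ne'
    have hA' := norm_nonneg (A n)
    constructor
    · have h := norm_sub_norm_le (A n) (f' x)
      rw [norm_sub_rev] at h
      have h4 : (c : ℝ)⁻¹ * ‖A n‖ ≤ ‖f' x‖ := by linarith
      calc ‖A n‖ = c * ((c : ℝ)⁻¹ * ‖A n‖) := by field_simp
        _ ≤ _ := by gcongr
    · have h := norm_sub_norm_le (f' x) (A n)
      have h4 : 2 - (c : ℝ)⁻¹ ≤ c := by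
        have : 0 < (c : ℝ)⁻¹ := by positivity
        nlinarith [sq_nonneg ((c : ℝ) - 1)]
      nlinarith
  have hn1 : ∀ n, ‖A n‖ₑ * volume (s ∩ t n) ≤ c * ∫⁻ x in s ∩ t n, ‖f' x‖ₑ := by
    intro n
    rw [← setLIntegral_const, ← lintegral_const_mul' _ _ ENNReal.coe_ne_top]
    refine lintegral_mono_ae ?_
    filter_upwards [hder n] with x hx
    exact (hreal n x hx).1
  have hn2 : ∀ n, ∫⁻ x in s ∩ t n, ‖f' x‖ₑ ≤ c * (‖A n‖ₑ * volume (s ∩ t n)) := by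
    intro n
    rw [← setLIntegral_const, ← lintegral_const_mul' _ _ ENNReal.coe_ne_top]
    refine lintegral_mono_ae ?_
    filter_upwards [hder n] with x hx
    exact (hreal n x hx).2
  have hint : ∫⁻ x in s, ‖f' x‖ₑ = ∑' n, ∫⁻ x in s ∩ t n, ‖f' x‖ₑ := by
    conv_lhs => rw [hunion]
    exact lintegral_iUnion sm hdisj _
  refine ⟨fun r => ∑' n, g n r, Measurable.tsum gm, fun r => ?_, fun r => ?_, ?_, ?_⟩
  · rw [hsum, ← ENNReal.tsum_mul_left]
    exact ENNReal.tsum_le_tsum fun n => g1 n r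
  · rw [hsum, ← ENNReal.tsum_mul_left]
    exact ENNReal.tsum_le_tsum fun n => g2 n r
  · rw [lintegral_tsum fun n => (gm n).aemeasurable, hint, ← ENNReal.tsum_mul_left]
    refine ENNReal.tsum_le_tsum fun n => (g3 n).trans ?_
    rw [pow_succ, mul_assoc]
    exact mul_le_mul_right (hn1 n) _
  · rw [lintegral_tsum fun n => (gm n).aemeasurable, hint, ← ENNReal.tsum_mul_left]
    refine ENNReal.tsum_le_tsum fun n => (hn2 n).trans ?_
    rw [pow_succ', mul_assoc]
    exact mul_le_mul_right (g4 n) _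

theorem ENNReal.le_of_forall_one_lt_le_pow_mul {a b : ENNReal} (k : ℕ)
    (h : ∀ c : ℝ≥0, 1 < c → a ≤ c ^ k * b) : a ≤ b := by
  have h1 : Tendsto (fun c : ℝ≥0 => (c : ENNReal) ^ k * b) (𝓝[>] 1) (𝓝 ((1 : ENNReal) ^ k * b)) := by
    refine ENNReal.Tendsto.mul_const ?_ (Or.inl (by simp))
    refine ENNReal.Tendsto.pow ?_
    exact (ENNReal.tendsto_coe.2 tendsto_id).mono_left nhdsWithin_le_nhds
  rw [one_pow, one_mul] at h1
  exact ge_of_tendsto h1 (by filter_upwards [self_mem_nhdsWithin] with c hc using h c hc)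

/-- The coarea formula for a real function that is differentiable, with nonzero derivative, within
a measurable set. -/
theorem measurable_and_lintegral_hausdorff_level {s : Set V} (hs : MeasurableSet s)
    {f : V → ℝ} {f' : V → V →L[ℝ] ℝ} (hf : ∀ x ∈ s, HasFDerivWithinAt f (f' x) s x)
    (h0 : ∀ x ∈ s, f' x ≠ 0) (hm : Measurable f) :
    Measurable (fun t => μHE[Module.finrank ℝ V - 1] (s ∩ f ⁻¹' {t})) ∧
      ∫⁻ t, μHE[Module.finrank ℝ V - 1] (s ∩ f ⁻¹' {t}) = ∫⁻ x in s, ‖f' x‖ₑ := by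
  set n := Module.finrank ℝ V - 1 with hn
  have hex := fun (c : ℝ≥0) (hc : 1 < c) =>
    exists_measurable_approx_hausdorff_level hs hf h0 hm hc
  constructor
  · obtain ⟨c, -, hc1, hc⟩ := exists_seq_strictAnti_tendsto (1 : ℝ≥0)
    choose g gm g1 g2 _ _ using fun j => hex (c j) (hc1 j)
    convert Measurable.iInf fun j => (gm j).const_mul ((c j : ENNReal) ^ n) using 2 with t
    refine le_antisymm (le_iInf fun j => g2 j t) ?_
    have hlim : Tendsto (fun j => ((c j : ENNReal) ^ n * (c j : ENNReal) ^ n) *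
        μHE[n] (s ∩ f ⁻¹' {t})) atTop (𝓝 (((1 : ENNReal) ^ n * (1 : ENNReal) ^ n) *
        μHE[n] (s ∩ f ⁻¹' {t}))) := by
      refine ENNReal.Tendsto.mul_const ?_ (Or.inl (by simp))
      have : Tendsto (fun j => (c j : ENNReal)) atTop (𝓝 1) := ENNReal.tendsto_coe.2 hc
      exact ENNReal.Tendsto.mul (ENNReal.Tendsto.pow this) (by simp) (ENNReal.Tendsto.pow this)
        (by simp)
    simp only [one_pow, one_mul] at hlim
    refine ge_of_tendsto' hlim fun j => (iInf_le _ j).trans ?_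
    rw [mul_assoc]
    gcongr
    exact g1 j t
  · refine le_antisymm (ENNReal.le_of_forall_one_lt_le_pow_mul (n + (Module.finrank ℝ V + 1))
      fun c hc => ?_) (ENNReal.le_of_forall_one_lt_le_pow_mul (Module.finrank ℝ V + 1 + n)
      fun c hc => ?_)
    · obtain ⟨g, gm, g1, g2, g3, g4⟩ := hex c hc
      calc _ ≤ ∫⁻ t, c ^ n * g t := lintegral_mono g2
        _ = c ^ n * ∫⁻ t, g t := lintegral_const_mul _ gm
        _ ≤ _ := by rw [pow_add, mul_assoc]; gcongr
    · obtain ⟨g, gm, g1, g2, g3, g4⟩ := hex c hc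
      refine g4.trans ?_
      rw [pow_add _ (Module.finrank ℝ V + 1) n, mul_assoc]
      refine mul_le_mul_right ?_ _
      rw [← lintegral_const_mul' _ _ (by finiteness)]
      exact lintegral_mono g1

end Coarea

/-! ### Slices of null sets and the geometry of space-time -/

/-- Almost every level set of a 1-Lipschitz function on an `(m + 1)`-null set is `m`-null. A cover
of the set by sets of small total size gives covers of the level sets, and the sizes of these
integrate to at most the former. -/
theorem ae_hausdorffMeasure_level_eq_zero {X : Type*} [EMetricSpace X] [MeasurableSpace X]
    [BorelSpace X] {f : X → ℝ} (hf : LipschitzWith 1 f) (m : ℕ) {Q : Set X}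
    (hQ : μH[(m + 1 : ℕ)] Q = 0) : ∀ᵐ τ : ℝ, μH[m] (Q ∩ f ⁻¹' {τ}) = 0 := by
  have hcov : ∀ n : ℕ, ∃ t : ℕ → Set X, Q ⊆ ⋃ i, t i ∧
      (∀ i, Metric.ediam (t i) ≤ (2⁻¹ : ENNReal) ^ n) ∧
      ∑' i, ⨆ _ : (t i).Nonempty, Metric.ediam (t i) ^ (m + 1) < (2⁻¹ : ENNReal) ^ n := by
    intro n
    have hpos : (0 : ENNReal) < 2⁻¹ ^ n := ENNReal.pow_pos (by simp) n
    rw [Measure.hausdorffMeasure_apply] at hQ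
    simp only [ENNReal.iSup_eq_zero] at hQ
    have h := (hQ _ hpos).trans_lt hpos
    simp only [iInf_lt_iff] at h
    obtain ⟨t, h1, h2, h3⟩ := h
    refine ⟨t, h1, h2, ?_⟩
    simpa only [ENNReal.rpow_natCast] using h3
  choose t t1 t2 t3 using hcov
  set c : ℕ → ℕ → ENNReal := fun n i => ⨆ _ : (t n i).Nonempty, Metric.ediam (t n i) ^ m with hc
  set J : ℕ → ℕ → Set ℝ := fun n i => toMeasurable volume (f '' t n i) with hJ
  have hJm : ∀ n i, MeasurableSet (J n i) := fun n i => measurableSet_toMeasurable _ _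
  set g : ℕ → ℝ → ENNReal := fun n τ => ∑' i, (J n i).indicator (fun _ => c n i) τ with hg
  have hgm : ∀ n, Measurable (g n) := fun n =>
    Measurable.tsum fun i => measurable_const.indicator (hJm n i)
  have hgint : ∀ n, ∫⁻ τ, g n τ ≤ (2⁻¹ : ENNReal) ^ n := by
    intro n
    rw [lintegral_tsum fun i => (measurable_const.indicator (hJm n i)).aemeasurable]
    refine (ENNReal.tsum_le_tsum fun i => ?_).trans (t3 n).le
    rw [lintegral_indicator (hJm n i), setLIntegral_const, measure_toMeasurable]
    rcases (t n i).eq_empty_or_nonempty with h | h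
    · simp [hc, h]
    · simp only [hc, h, iSup_pos]
      rw [pow_succ]
      gcongr
      calc volume (f '' t n i) ≤ Metric.ediam (f '' t n i) := Real.volume_le_diam _
        _ ≤ Metric.ediam (t n i) := by simpa using hf.ediam_image_le (t n i)
  have hfin : ∀ᵐ τ : ℝ, ∑' n, g n τ < ⊤ := by
    refine ae_lt_top (Measurable.tsum hgm) (ne_of_lt ?_)
    rw [lintegral_tsum fun n => (hgm n).aemeasurable]
    refine (ENNReal.tsum_le_tsum hgint).trans_lt ?_
    rw [ENNReal.tsum_geometric]
    simp
  filter_upwards [hfin] with τ hτ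
  have hlim : Tendsto (fun n => g n τ) atTop (𝓝 0) :=
    ENNReal.tendsto_atTop_zero_of_tsum_ne_top hτ.ne
  have hr : Tendsto (fun n : ℕ => (2⁻¹ : ENNReal) ^ n) atTop (𝓝 0) :=
    ENNReal.tendsto_pow_atTop_nhds_zero_of_lt_one (by simp)
  have h := Measure.hausdorffMeasure_le_liminf_tsum (ι := fun n => {i // τ ∈ f '' t n i}) (m : ℝ)
    (Q ∩ f ⁻¹' {τ}) _ hr (fun n i => t n i) (Eventually.of_forall fun n i => t2 n i)
    (Eventually.of_forall fun n x hx => by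
      obtain ⟨i, hi⟩ := mem_iUnion.1 (t1 n hx.1)
      exact mem_iUnion.2 ⟨⟨i, x, hi, hx.2⟩, hi⟩)
  refine le_antisymm (h.trans ?_) zero_le
  rw [← hlim.liminf_eq]
  refine liminf_le_liminf (Eventually.of_forall fun n => ?_)
  simp only [ENNReal.rpow_natCast]
  refine (tsum_subtype {i | τ ∈ f '' t n i} (fun i => Metric.ediam (t n i) ^ m)).trans_le ?_
  refine ENNReal.tsum_le_tsum fun i => ?_
  by_cases hi : τ ∈ f '' t n i
  · have : (t n i).Nonempty := Set.image_nonempty.1 ⟨τ, hi⟩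
    rw [indicator_of_mem (by exact hi), indicator_of_mem (subset_toMeasurable _ _ hi)]
    simp [hc, this]
  · rw [indicator_of_notMem (by exact hi)]
    exact zero_le

theorem euclideanHausdorffMeasure_eq_zero_iff {X : Type*} [EMetricSpace X] [MeasurableSpace X]
    [BorelSpace X] (k : ℕ) (s : Set X) : μHE[k] s = 0 ↔ μH[k] s = 0 := by
  rw [Measure.euclideanHausdorffMeasure_def, Measure.smul_apply, ENNReal.smul_def, smul_eq_mul,
    mul_eq_zero, ENNReal.coe_eq_zero,
    or_iff_right (Measure.addHaarScalarFactor_volume_hausdorffMeasure_ne_zero k)]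

theorem LipschitzWith.euclideanHausdorffMeasure_image_eq_zero {X Y : Type*} [EMetricSpace X]
    [EMetricSpace Y] [MeasurableSpace X] [BorelSpace X] [MeasurableSpace Y] [BorelSpace Y]
    {K : ℝ≥0} {f : X → Y} (h : LipschitzWith K f) {k : ℕ} {s : Set X} (hs : μHE[k] s = 0) :
    μHE[k] (f '' s) = 0 := by
  have := (h.lipschitzOnWith (s := s)).euclideanHausdorffMeasure_image_le k
  simpa [hs] using this

section SpaceTime

variable {d : ℕ}

@[simp] theorem stPoint_fst (t : ℝ) (x : Space d) : (stPoint t x).fst = t := rfl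

@[simp] theorem stPoint_snd (t : ℝ) (x : Space d) : (stPoint t x).snd = x := rfl

@[simp] theorem stPoint_fst_snd (p : SpaceTime d) : stPoint p.fst p.snd = p := rfl

theorem SpaceTime.norm_sq (p : SpaceTime d) : ‖p‖ ^ 2 = p.fst ^ 2 + ‖p.snd‖ ^ 2 := by
  rw [WithLp.prod_norm_sq_eq_of_L2, Real.norm_eq_abs, sq_abs]

theorem SpaceTime.inner_def (p q : SpaceTime d) :
    inner ℝ p q = p.fst * q.fst + inner ℝ p.snd q.snd := by
  rw [WithLp.prod_inner_apply]
  simp [mul_comm]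

theorem SpaceTime.abs_fst_le (p : SpaceTime d) : |p.fst| ≤ ‖p‖ :=
  abs_le_of_sq_le_sq (by rw [SpaceTime.norm_sq]; nlinarith [sq_nonneg ‖p.snd‖]) (norm_nonneg _)

theorem SpaceTime.norm_snd_le (p : SpaceTime d) : ‖p.snd‖ ≤ ‖p‖ :=
  le_of_sq_le_sq (by rw [SpaceTime.norm_sq p]; nlinarith [sq_nonneg p.fst]) (norm_nonneg _)

theorem SpaceTime.norm_le (p : SpaceTime d) : ‖p‖ ≤ |p.fst| + ‖p.snd‖ := by
  refine le_of_sq_le_sq ?_ (by positivity)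
  rw [SpaceTime.norm_sq, ← sq_abs p.fst]
  nlinarith [abs_nonneg p.fst, norm_nonneg p.snd]

theorem SpaceTime.lipschitzWith_fst : LipschitzWith 1 (fun p : SpaceTime d => p.fst) :=
  LipschitzWith.of_dist_le_mul fun p q => by
    rw [NNReal.coe_one, one_mul, Real.dist_eq, dist_eq_norm]
    exact SpaceTime.abs_fst_le (p - q)

theorem SpaceTime.lipschitzWith_snd : LipschitzWith 1 (fun p : SpaceTime d => p.snd) :=
  LipschitzWith.of_dist_le_mul fun p q => by
    rw [NNReal.coe_one, one_mul, dist_eq_norm, dist_eq_norm]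
    exact SpaceTime.norm_snd_le (p - q)

theorem continuous_stPoint : Continuous fun q : ℝ × Space d => stPoint q.1 q.2 :=
  WithLp.prod_continuous_toLp 2 ℝ (Space d)

theorem isometry_stPoint (t : ℝ) : Isometry (stPoint (d := d) t) :=
  Isometry.of_dist_eq fun x y => by
    have h : ‖stPoint t x - stPoint t y‖ ^ 2 = ‖x - y‖ ^ 2 := by
      rw [SpaceTime.norm_sq]
      simp
    rw [dist_eq_norm, dist_eq_norm]
    exact (sq_eq_sq₀ (norm_nonneg _) (norm_nonneg _)).1 h

theorem volume_image_snd_le (s : Set (SpaceTime d)) :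
    volume ((fun p : SpaceTime d => p.snd) '' s) ≤ μHE[d] s := by
  rw [← EuclideanSpace.euclideanHausdorffMeasure_eq_volume]
  simpa using
    (SpaceTime.lipschitzWith_snd.lipschitzOnWith (s := s)).euclideanHausdorffMeasure_image_le d

theorem ae_hausdorff_slice_eq_zero (hd : 1 ≤ d) {Q : Set (SpaceTime d)} (hQ : μHE[d] Q = 0) :
    ∀ᵐ τ : ℝ, μHE[d - 1] {x : Space d | stPoint τ x ∈ Q} = 0 := by
  have h := ae_hausdorffMeasure_level_eq_zero SpaceTime.lipschitzWith_fst (d - 1) (Q := Q)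
    (by rw [Nat.sub_add_cancel hd, ← euclideanHausdorffMeasure_eq_zero_iff]; exact hQ)
  filter_upwards [h] with τ hτ
  rw [← euclideanHausdorffMeasure_eq_zero_iff] at hτ
  rw [← (isometry_stPoint τ).euclideanHausdorffMeasure_image]
  refine measure_mono_null ?_ hτ
  rintro _ ⟨x, hx, rfl⟩
  exact ⟨hx, by simp⟩

end SpaceTime

/-! ### Boundaries of Lipschitz domains and jump times -/

section Graph

variable {F : Type*} [NormedAddCommGroup F] [InnerProductSpace ℝ F]

theorem mem_frontier_iff_of_subgraph {G : Set F} (hG : IsOpen G) {p e : F} {g : F → ℝ} {r : ℝ}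
    (he : ‖e‖ = 1) (hg : Continuous g)
    (h : ∀ y ∈ Metric.ball p r, (y ∈ G ↔ inner ℝ e y < g (y - inner ℝ e y • e)))
    {y : F} (hy : y ∈ Metric.ball p r) :
    y ∈ frontier G ↔ inner ℝ e y = g (y - inner ℝ e y • e) := by
  rw [hG.frontier_eq, Set.mem_sdiff]
  constructor
  · rintro ⟨h1, h2⟩
    rw [h y hy, not_lt] at h2
    by_contra hne
    have hlt : g (y - inner ℝ e y • e) < inner ℝ e y := lt_of_le_of_ne h2 (Ne.symm hne)
    have hopen : ∀ᶠ z in 𝓝 y, g (z - inner ℝ e z • e) < inner ℝ e z :=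
      (by fun_prop : Continuous fun z => g (z - inner ℝ e z • e)).continuousAt.eventually_lt
        (by fun_prop : Continuous fun z : F => inner ℝ e z).continuousAt hlt
    obtain ⟨z, hz, hz1, hz2⟩ := ((mem_closure_iff_frequently.1 h1).and_eventually
      (hopen.and (Metric.isOpen_ball.mem_nhds hy))).exists
    exact lt_asymm hz1 ((h z hz2).1 hz)
  · intro hey
    refine ⟨?_, fun hyG => ((h y hy).1 hyG).ne hey⟩
    have hlim : Tendsto (fun s : ℝ => y - s • e) (𝓝[>] 0) (𝓝 y) := by
      have : Continuous fun s : ℝ => y - s • e := by fun_prop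
      simpa using (this.tendsto 0).mono_left nhdsWithin_le_nhds
    refine mem_closure_of_tendsto hlim ?_
    filter_upwards [hlim.eventually (Metric.isOpen_ball.mem_nhds hy), self_mem_nhdsWithin]
      with s hs (hs0 : 0 < s)
    rw [h _ hs]
    have h1 : inner ℝ e (y - s • e) = inner ℝ e y - s := by
      rw [inner_sub_right, real_inner_smul_right, real_inner_self_eq_norm_sq, he]; ring
    have h2 : y - s • e - (inner ℝ e y - s) • e = y - inner ℝ e y • e := by module
    rw [h1, h2, ← hey]
    linarith

/-- At a point with an outer normal, the boundary is tangent to the hyperplane orthogonal to the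
normal. -/
theorem IsOuterNormal.eventually_abs_inner_le {G : Set F} (hG : IsOpen G) {p ν : F}
    (h : IsOuterNormal G p ν) {ε : ℝ} (hε : 0 < ε) :
    ∀ᶠ q in 𝓝 p, q ∈ frontier G → |inner ℝ (q - p) ν| ≤ ε * ‖q - p‖ := by
  filter_upwards [eventually_eventually_nhds.2 (h.2.2 ε hε)] with q hq hqG
  rw [hG.frontier_eq, Set.mem_sdiff] at hqG
  rw [abs_le]
  constructor
  · by_contra! hlt
    exact hqG.2 (hq.self_of_nhds.1 hlt)
  · by_contra! hlt
    have hopen : ∀ᶠ y in 𝓝 q, ε * ‖y - p‖ < inner ℝ (y - p) ν :=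
      (by fun_prop : Continuous fun y => ε * ‖y - p‖).continuousAt.eventually_lt
        (by fun_prop : Continuous fun y : F => inner ℝ (y - p) ν).continuousAt hlt
    obtain ⟨y, hy, hy1, hy2⟩ := ((mem_closure_iff_frequently.1 hqG.1).and_eventually
      (hopen.and hq)).exists
    exact hy2.2 hy1 hy

end Graph

section Chart

variable {d : ℕ}

theorem finrank_spaceTime : Module.finrank ℝ (SpaceTime d) = d + 1 := by
  rw [(WithLp.linearEquiv 2 ℝ (ℝ × Space d)).finrank_eq]
  simp [add_comm]

/-- Lipschitz parametrizations of the boundary of a Lipschitz domain in space-time. -/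
theorem IsLipschitzDomain.exists_parametrization {G : Set (SpaceTime d)} (hG : IsLipschitzDomain G)
    {p : SpaceTime d} (hp : p ∈ frontier G) :
    ∃ r > 0, ∃ R : ℝ, ∃ K : ℝ≥0, ∃ ψ : Space d → SpaceTime d, LipschitzWith K ψ ∧
      frontier G ∩ Metric.ball p r ⊆ ψ '' Metric.ball 0 R ∧
      ∀ z, ψ z ∈ Metric.ball p r → ψ z ∈ frontier G := by
  obtain ⟨e, K, g, r, he, hg, hr, hgr⟩ := hG.graph p hp
  have he0 : e ≠ 0 := by rintro rfl; simp at he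
  have hfr : Module.finrank ℝ (ℝ ∙ e)ᗮ = d := by
    have := (ℝ ∙ e).finrank_add_finrank_orthogonal
    rw [finrank_span_singleton he0, finrank_spaceTime] at this
    omega
  have hι := ((stdOrthonormalBasis ℝ (ℝ ∙ e)ᗮ).reindex (finCongr hfr)).repr.symm
  set ι : Space d →ₗᵢ[ℝ] SpaceTime d :=
    (ℝ ∙ e)ᗮ.subtypeₗᵢ.comp hι.toLinearIsometry with hιdef
  have hιe : ∀ z, inner ℝ e (ι z) = 0 := fun z =>
    (Submodule.mem_orthogonal_singleton_iff_inner_right).1 (hι z).2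
  refine ⟨r, hr, ‖p‖ + r, 1 + K, fun z => ι z + g (ι z) • e, ?_, ?_, ?_⟩
  · refine ι.lipschitz.add (LipschitzWith.of_dist_le_mul fun x y => ?_)
    rw [dist_eq_norm, ← sub_smul, norm_smul, he, mul_one, ← dist_eq_norm]
    calc dist (g (ι x)) (g (ι y)) ≤ K * dist (ι x) (ι y) := hg.dist_le_mul _ _
      _ = K * dist x y := by rw [ι.dist_map]
  · rintro y ⟨hy, hyr⟩
    have hy' := (mem_frontier_iff_of_subgraph hG.isOpen he hg.continuous hgr hyr).1 hy
    have hmem : y - inner ℝ e y • e ∈ (ℝ ∙ e)ᗮ := by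
      rw [Submodule.mem_orthogonal_singleton_iff_inner_right, inner_sub_right,
        real_inner_smul_right, real_inner_self_eq_norm_sq, he]
      ring
    have hιz : ι (hι.symm ⟨_, hmem⟩) = y - inner ℝ e y • e := by
      simp [hιdef]
    refine ⟨hι.symm ⟨_, hmem⟩, ?_, ?_⟩
    · rw [mem_ball_zero_iff, ← ι.norm_map, hιz]
      have h1 : ‖y - inner ℝ e y • e‖ ^ 2 ≤ ‖y‖ ^ 2 := by
        rw [norm_sub_sq_real, norm_smul, he, real_inner_smul_right, real_inner_comm, mul_one,
          Real.norm_eq_abs, sq_abs]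
        nlinarith [sq_nonneg (inner ℝ y e)]
      have h2 := le_of_sq_le_sq h1 (norm_nonneg _)
      have h3 : ‖y‖ ≤ ‖p‖ + ‖y - p‖ := by
        have := norm_add_le p (y - p)
        simpa using this
      rw [mem_ball_iff_norm] at hyr
      linarith
    · simp only [hιz, ← hy']
      abel
  · intro z hz
    have h1 : inner ℝ e (ι z + g (ι z) • e) = g (ι z) := by
      rw [inner_add_right, real_inner_smul_right, real_inner_self_eq_norm_sq, he, hιe]; ring
    rw [mem_frontier_iff_of_subgraph hG.isOpen he hg.continuous hgr hz, h1]
    simp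

theorem IsLipschitzDomain.hausdorff_frontier_lt_top {G : Set (SpaceTime d)}
    (hG : IsLipschitzDomain G) : μHE[d] (frontier G) < ⊤ := by
  have hc : IsCompact (frontier G) :=
    Metric.isCompact_of_isClosed_isBounded isClosed_frontier
      (hG.isBounded.closure.subset frontier_subset_closure)
  refine hc.measure_lt_top_of_nhdsWithin fun p hp => ?_
  obtain ⟨r, hr, R, K, ψ, hψ, hsub, -⟩ := hG.exists_parametrization hp
  refine ⟨frontier G ∩ Metric.ball p r,
    inter_mem_nhdsWithin _ (Metric.ball_mem_nhds p hr), ?_⟩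
  refine (measure_mono hsub).trans_lt ?_
  refine ((hψ.lipschitzOnWith).euclideanHausdorffMeasure_image_le d).trans_lt ?_
  rw [EuclideanSpace.euclideanHausdorffMeasure_eq_volume]
  exact ENNReal.mul_lt_top (by simp) Metric.isBounded_ball.measure_lt_top

/-- The projection to space of the set of boundary points with a horizontal outer normal is null:
in a Lipschitz parametrization, the projection is almost everywhere differentiable, and at such a
point its derivative maps into the hyperplane orthogonal to the normal. -/
theorem IsLipschitzDomain.volume_snd_image_horizontal_normal {G : Set (SpaceTime d)}
    (hG : IsLipschitzDomain G) :
    volume ((fun p : SpaceTime d => p.snd) ''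
      {p | ∃ n : Space d, IsOuterNormal G p (stPoint 0 n)}) = 0 := by
  set S : Set (SpaceTime d) := {p | ∃ n : Space d, IsOuterNormal G p (stPoint 0 n)} with hS
  have hloc : ∀ p ∈ S, ∃ U ∈ 𝓝 p, volume ((fun p : SpaceTime d => p.snd) '' (S ∩ U)) = 0 := by
    rintro p ⟨n₀, hn₀⟩
    obtain ⟨r, hr, R, K, ψ, hψ, hsub, hfr⟩ := hG.exists_parametrization hn₀.1
    refine ⟨Metric.ball p r, Metric.ball_mem_nhds p hr, ?_⟩
    set θ : Space d → Space d := fun z => (ψ z).snd with hθ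
    have hθL : LipschitzWith K θ := by
      have := SpaceTime.lipschitzWith_snd.comp hψ
      rwa [one_mul] at this
    set D : Set (Space d) := {z | ψ z ∈ S ∩ Metric.ball p r ∧ DifferentiableAt ℝ θ z} with hD
    have hsub' : (fun p : SpaceTime d => p.snd) '' (S ∩ Metric.ball p r) ⊆
        θ '' D ∪ θ '' {z | ¬ DifferentiableAt ℝ θ z} := by
      rintro _ ⟨q, ⟨hqS, hqr⟩, rfl⟩
      obtain ⟨n, hn⟩ := hqS
      obtain ⟨z, -, rfl⟩ := hsub ⟨hn.1, hqr⟩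
      by_cases hz : DifferentiableAt ℝ θ z
      · exact Or.inl ⟨z, ⟨⟨⟨n, hn⟩, hqr⟩, hz⟩, rfl⟩
      · exact Or.inr ⟨z, hz, rfl⟩
    refine measure_mono_null hsub' (measure_union_null ?_ ?_)
    · refine addHaar_image_eq_zero_of_det_fderivWithin_eq_zero volume (f' := fderiv ℝ θ)
        (fun z hz => hz.2.hasFDerivAt.hasFDerivWithinAt) ?_
      rintro z ⟨⟨⟨n, hn⟩, hzr⟩, hz⟩
      have hn0 : n ≠ 0 := by
        rintro rfl
        exact hn.2.1 rfl
      have h1 : HasFDerivAt (fun y => inner ℝ n (θ y)) ((innerSL ℝ n).comp (fderiv ℝ θ z)) z :=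
        (innerSL ℝ n).hasFDerivAt.comp z hz.hasFDerivAt
      have h2 : HasFDerivAt (fun y => inner ℝ n (θ y)) (0 : Space d →L[ℝ] ℝ) z := by
        rw [hasFDerivAt_iff_isLittleO, Asymptotics.isLittleO_iff]
        intro ε hε
        have hK : (0 : ℝ) < K + 1 := by positivity
        have hψz : Tendsto ψ (𝓝 z) (𝓝 (ψ z)) := hψ.continuous.tendsto z
        filter_upwards [hψz.eventually (hn.eventually_abs_inner_le hG.isOpen (div_pos hε hK)),
          hψz.eventually (Metric.isOpen_ball.mem_nhds hzr)] with y hy hyr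
        have := hy (hfr y hyr)
        rw [SpaceTime.inner_def] at this
        have hlip : ‖ψ y - ψ z‖ ≤ K * ‖y - z‖ := hψ.norm_sub_le y z
        rw [zero_apply, sub_zero, Real.norm_eq_abs, ← inner_sub_right,
          real_inner_comm]
        calc |inner ℝ (θ y - θ z) n| = |(ψ y - ψ z).fst * (stPoint 0 n).fst +
              inner ℝ (ψ y - ψ z).snd (stPoint 0 n).snd| := by simp [hθ]
          _ ≤ ε / (K + 1) * ‖ψ y - ψ z‖ := this
          _ ≤ ε / (K + 1) * ((K + 1) * ‖y - z‖) := by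
              gcongr
              refine hlip.trans ?_
              gcongr
              linarith
          _ = ε * ‖y - z‖ := by field_simp
      have h3 := h1.unique h2
      by_contra hdet
      have hu : Function.Surjective (fderiv ℝ θ z : Space d →ₗ[ℝ] Space d) :=
        (LinearMap.equivOfDetNeZero _ hdet).surjective
      obtain ⟨w, hw⟩ := hu n
      have h4 := congrArg (fun L : Space d →L[ℝ] ℝ => L w) h3
      have hw' : fderiv ℝ θ z w = n := hw
      simp [hw', hn0] at h4
    · rw [← EuclideanSpace.euclideanHausdorffMeasure_eq_volume]
      refine hθL.euclideanHausdorffMeasure_image_eq_zero ?_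
      rw [EuclideanSpace.euclideanHausdorffMeasure_eq_volume]
      exact ae_iff.1 hθL.ae_differentiableAt
  choose! U hU hU0 using hloc
  obtain ⟨t, htS, htc, hcov⟩ := TopologicalSpace.countable_cover_nhdsWithin
    fun p hp => mem_nhdsWithin_of_mem_nhds (a := p) (t := S) (hU p hp)
  have hsub : (fun p : SpaceTime d => p.snd) '' S ⊆
      ⋃ p ∈ t, (fun p : SpaceTime d => p.snd) '' (S ∩ U p) := by
    rintro _ ⟨q, hq, rfl⟩
    obtain ⟨p, hp, hqp⟩ := mem_iUnion₂.1 (hcov hq)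
    exact mem_iUnion₂.2 ⟨p, hp, q, ⟨hq, hqp⟩, rfl⟩
  exact measure_mono_null hsub ((measure_biUnion_null_iff htc).2 fun p hp => hU0 p (htS hp))

end Chart

section Jumps

/-- A function has only countably many local maximal values: each of the countably many basic open
sets is responsible for at most one of them. -/
theorem countable_image_isLocalMaxOn {X : Type*} [TopologicalSpace X] [SecondCountableTopology X]
    (f : X → ℝ) (S : Set X) : (f '' {x ∈ S | IsLocalMaxOn f S x}).Countable := by
  have hsub : f '' {x ∈ S | IsLocalMaxOn f S x} ⊆ ⋃ U ∈ TopologicalSpace.countableBasis X,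
      {v | ∃ x ∈ U ∩ S, f x = v ∧ ∀ y ∈ U ∩ S, f y ≤ v} := by
    rintro _ ⟨x, ⟨hxS, hx⟩, rfl⟩
    obtain ⟨W, hW, hWx⟩ := mem_nhdsWithin_iff_exists_mem_nhds_inter.1 hx
    obtain ⟨U, hU, hxU, hUW⟩ :=
      (TopologicalSpace.isBasis_countableBasis X).mem_nhds_iff.1 hW
    exact mem_iUnion₂.2 ⟨U, hU, x, ⟨hxU, hxS⟩, rfl, fun y hy => hWx ⟨hUW hy.1, hy.2⟩⟩
  refine ((TopologicalSpace.countable_countableBasis X).biUnion fun U _ => ?_).mono hsub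
  refine Set.Subsingleton.countable ?_
  rintro _ ⟨x, hx, rfl, hx'⟩ _ ⟨y, hy, rfl, hy'⟩
  exact le_antisymm (hy' x hx) (hx' y hy)

variable {d : ℕ} {T : ℝ} {Ω : ℝ → Set (Space d)}

/-- The times at which the boundary of the space-time domain has points that do not belong to the
boundary of the time slice; this is where the moving domain jumps. -/
def jumpTimes (T : ℝ) (Ω : ℝ → Set (Space d)) : Set ℝ :=
  {t | t ∈ Ioo 0 T ∧ ∃ x, stPoint t x ∈ frontier (spaceTimeDomain T Ω) ∧ x ∉ frontier (Ω t)}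

theorem isOpen_slice (hG : IsOpen (spaceTimeDomain T Ω)) {t : ℝ} (ht : t ∈ Ioo 0 T) :
    IsOpen (Ω t) := by
  have : Ω t = stPoint t ⁻¹' spaceTimeDomain T Ω := by
    ext x
    exact ⟨fun h => ⟨ht, h⟩, fun h => h.2⟩
  rw [this]
  exact hG.preimage (isometry_stPoint t).continuous

theorem stPoint_mem_frontier (hG : IsOpen (spaceTimeDomain T Ω)) {t : ℝ} (ht : t ∈ Ioo 0 T)
    {x : Space d} (hx : x ∈ frontier (Ω t)) : stPoint t x ∈ frontier (spaceTimeDomain T Ω) := by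
  rw [(isOpen_slice hG ht).frontier_eq] at hx
  rw [hG.frontier_eq]
  refine ⟨?_, fun h => hx.2 h.2⟩
  exact (map_mem_closure (isometry_stPoint t).continuous hx.1 fun y hy => ⟨ht, hy⟩)

/-- A boundary point of the space-time domain that is not on the boundary of its time slice is a
local extremum of the time on the boundary: otherwise a segment in the direction of the graph
would lead from the boundary into the domain at a nearby point of the time slice. -/
theorem IsLipschitzDomain.isLocalExtrOn_time (hG : IsLipschitzDomain (spaceTimeDomain T Ω))
    {p : SpaceTime d} (hp : p ∈ frontier (spaceTimeDomain T Ω)) (ht : p.fst ∈ Ioo 0 T)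
    (hx : p.snd ∉ frontier (Ω p.fst)) :
    IsLocalMaxOn (fun q : SpaceTime d => q.fst) (frontier (spaceTimeDomain T Ω)) p ∨
      IsLocalMaxOn (fun q : SpaceTime d => -q.fst) (frontier (spaceTimeDomain T Ω)) p := by
  have hopen := isOpen_slice hG.isOpen ht
  have hpG : p ∉ spaceTimeDomain T Ω := by
    rw [hG.isOpen.frontier_eq] at hp
    exact hp.2
  have hxcl : p.snd ∉ closure (Ω p.fst) := fun h => hx (by
    rw [hopen.frontier_eq]
    exact ⟨h, fun h' => hpG ⟨ht, h'⟩⟩)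
  have hnhds : ∀ᶠ q : SpaceTime d in 𝓝 p, q.fst = p.fst → q ∉ spaceTimeDomain T Ω := by
    have h1 : ∀ᶠ q : SpaceTime d in 𝓝 p, q.snd ∈ (closure (Ω p.fst))ᶜ :=
      SpaceTime.lipschitzWith_snd.continuous.continuousAt.eventually
        (isClosed_closure.isOpen_compl.mem_nhds hxcl)
    filter_upwards [h1] with q hq hqt hqG
    exact hq (subset_closure (hqt ▸ hqG.2))
  obtain ⟨e, K, g, r, he, hg, hr, hgr⟩ := hG.graph p hp
  obtain ⟨δ, hδ, hδG⟩ := Metric.eventually_nhds_iff.1 hnhds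
  have hρ : 0 < min r δ := lt_min hr hδ
  -- Moving from a boundary point against the direction of the graph leads into the domain, hence
  -- not to a nearby point at the time of `p`.
  have hmove : ∀ q ∈ frontier (spaceTimeDomain T Ω), dist q p < min r δ → ∀ s > (0 : ℝ),
      dist (q - s • e) p < min r δ → (q - s • e).fst ≠ p.fst := by
    intro q hq hqp s hs hsp hfst
    have hq' := (mem_frontier_iff_of_subgraph hG.isOpen he hg.continuous hgr
      (hqp.trans_le (min_le_left _ _))).1 hq
    refine hδG (hsp.trans_le (min_le_right _ _)) hfst
      ((hgr _ (hsp.trans_le (min_le_left _ _))).2 ?_)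
    have h1 : inner ℝ e (q - s • e) = inner ℝ e q - s := by
      rw [inner_sub_right, real_inner_smul_right, real_inner_self_eq_norm_sq, he]; ring
    have h2 : q - s • e - (inner ℝ e q - s) • e = q - inner ℝ e q • e := by module
    rw [h1, h2, ← hq']
    linarith
  have he0 : e.fst ≠ 0 := by
    intro he0
    refine hmove p hp (by simpa using hρ) (min r δ / 2) (by positivity) ?_ (by simp [he0])
    rw [dist_eq_norm, sub_sub_cancel_left, norm_neg, norm_smul, he, mul_one, Real.norm_eq_abs,
      abs_of_pos (by positivity)]
    linarith
  have hsign : ∀ᶠ q in 𝓝[frontier (spaceTimeDomain T Ω)] p, (q.fst - p.fst) / e.fst ≤ 0 := by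
    have hC : 0 < 1 + |e.fst|⁻¹ := by positivity
    have hball := mem_nhdsWithin_of_mem_nhds (t := frontier (spaceTimeDomain T Ω))
      (Metric.ball_mem_nhds p (div_pos hρ hC))
    filter_upwards [hball, self_mem_nhdsWithin] with q hq hqf
    by_contra! hs
    rw [Metric.mem_ball, lt_div_iff₀ hC] at hq
    have hqp : dist q p < min r δ := by
      have : 0 ≤ dist q p * |e.fst|⁻¹ := by positivity
      linarith
    refine hmove q hqf hqp _ hs ?_ ?_
    · have h1 : |q.fst - p.fst| ≤ dist q p := by
        rw [dist_eq_norm]; exact SpaceTime.abs_fst_le (q - p)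
      calc dist (q - ((q.fst - p.fst) / e.fst) • e) p
          = ‖(q - p) - ((q.fst - p.fst) / e.fst) • e‖ := by rw [dist_eq_norm]; congr 1; abel
        _ ≤ ‖q - p‖ + ‖((q.fst - p.fst) / e.fst) • e‖ := norm_sub_le _ _
        _ = dist q p + |q.fst - p.fst| * |e.fst|⁻¹ := by
            rw [norm_smul, he, mul_one, Real.norm_eq_abs, abs_div, dist_eq_norm, div_eq_mul_inv]
        _ ≤ dist q p + dist q p * |e.fst|⁻¹ := by gcongr
        _ < min r δ := by linarith
    · simp [he0]
  rcases lt_or_gt_of_ne he0 with h | h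
  · right
    filter_upwards [hsign] with q hq
    rcases div_nonpos_iff.1 hq with h' | h'
    · exact neg_le_neg (sub_nonneg.1 h'.1)
    · exact absurd h'.2 (not_le.2 h)
  · left
    filter_upwards [hsign] with q hq
    rcases div_nonpos_iff.1 hq with h' | h'
    · exact absurd h'.2 (not_le.2 h)
    · exact sub_nonpos.1 h'.1

theorem IsLipschitzDomain.countable_jumpTimes (hG : IsLipschitzDomain (spaceTimeDomain T Ω)) :
    (jumpTimes T Ω).Countable := by
  have h1 := countable_image_isLocalMaxOn (fun q : SpaceTime d => q.fst)
    (frontier (spaceTimeDomain T Ω))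
  have h2 := (countable_image_isLocalMaxOn (fun q : SpaceTime d => -q.fst)
    (frontier (spaceTimeDomain T Ω))).image (fun v => -v)
  refine (h1.union h2).mono ?_
  rintro t ⟨ht, x, hx, hxt⟩
  rcases hG.isLocalExtrOn_time hx ht hxt with h | h
  · exact Or.inl ⟨_, ⟨hx, h⟩, rfl⟩
  · exact Or.inr ⟨_, ⟨_, ⟨hx, h⟩, rfl⟩, by simp⟩

end Jumps

/-! ### The normal velocity and the moving boundary -/

section Velocity

variable {d : ℕ} {T : ℝ} {Ω : ℝ → Set (Space d)}

theorem IsNormalVelocityAt.normalVelocity_eq {t : ℝ} {x : Space d} {v : ℝ}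
    (h : IsNormalVelocityAt T Ω t x v) : normalVelocity T Ω t x = v := by
  have hex : ∃ v, IsNormalVelocityAt T Ω t x v := ⟨v, h⟩
  rw [normalVelocity, dif_pos hex]
  exact hex.choose_spec.unique h

theorem isNormalVelocityAt_normalVelocity {t : ℝ} {x : Space d}
    (h : normalVelocity T Ω t x ≠ 0) : IsNormalVelocityAt T Ω t x (normalVelocity T Ω t x) := by
  by_cases hex : ∃ v, IsNormalVelocityAt T Ω t x v
  · rw [hex.choose_spec.normalVelocity_eq]
    exact hex.choose_spec
  · exact absurd (by rw [normalVelocity, dif_neg hex]) h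

/-- Where the normal velocity `v` is nonzero, the time line crosses the boundary transversally,
entering the domain if `0 < v` and leaving it if `v < 0`. -/
theorem IsNormalVelocityAt.eventually_crossing {t : ℝ} {x : Space d} {v : ℝ}
    (h : IsNormalVelocityAt T Ω t x v) (hv : v ≠ 0) :
    ∀ᶠ τ in 𝓝 t, (0 < (τ - t) * v → stPoint τ x ∈ spaceTimeDomain T Ω) ∧
      ((τ - t) * v < 0 → stPoint τ x ∉ spaceTimeDomain T Ω) := by
  obtain ⟨n, -, -, hn⟩ := h
  have hv' : 0 < |v| := abs_pos.2 hv
  have hlim : Tendsto (fun τ : ℝ => stPoint τ x) (𝓝 t) (𝓝 (stPoint t x)) :=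
    (continuous_stPoint.comp (by fun_prop : Continuous fun τ : ℝ => (τ, x))).tendsto t
  filter_upwards [hlim.eventually (hn.2.2 (|v| / 2) (by positivity))] with τ hτ
  have hnorm : ‖stPoint τ x - stPoint t x‖ = |τ - t| := by
    refine le_antisymm ?_ ?_
    · simpa using SpaceTime.norm_le (stPoint τ x - stPoint t x)
    · simpa using SpaceTime.abs_fst_le (stPoint τ x - stPoint t x)
  have hinner : inner ℝ (stPoint τ x - stPoint t x) (stPoint (-v) n) = -((τ - t) * v) := by
    rw [SpaceTime.inner_def]
    simp
  rw [hnorm, hinner] at hτ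
  have habs : |τ - t| * |v| = |(τ - t) * v| := (abs_mul _ _).symm
  constructor
  · intro hpos
    rw [abs_of_pos hpos] at habs
    exact hτ.1 (by linarith)
  · intro hneg
    rw [abs_of_neg hneg] at habs
    exact hτ.2 (by linarith)

/-- The part of the lateral boundary where the normal velocity is nonzero, away from the jump
times. -/
def movingBoundary (T : ℝ) (Ω : ℝ → Set (Space d)) : Set (SpaceTime d) :=
  {p | p ∈ frontier (spaceTimeDomain T Ω) ∧ p.fst ∈ Ioo 0 T \ jumpTimes T Ω ∧
    normalVelocity T Ω p.fst p.snd ≠ 0}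

/-- Almost every time line meets the boundary, except at jump times, only in points with nonzero
normal velocity. -/
theorem IsMovingDomain.volume_snd_image_not_moving (hΩ : IsMovingDomain T Ω) :
    volume ((fun p : SpaceTime d => p.snd) '' ({p | p ∈ frontier (spaceTimeDomain T Ω) ∧
      p.fst ∈ Ioo 0 T \ jumpTimes T Ω} \ movingBoundary T Ω)) = 0 := by
  set Q : Set (SpaceTime d) := {p | ¬ (p ∈ lateralBoundary T Ω →
    ∃ v, IsNormalVelocityAt T Ω p.fst p.snd v)} with hQ
  have hQ0 : μHE[d] Q = 0 := ae_iff.1 hΩ.normal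
  have h1 : volume ((fun p : SpaceTime d => p.snd) '' Q) = 0 :=
    le_antisymm ((volume_image_snd_le Q).trans hQ0.le) zero_le
  refine measure_mono_null ?_ (measure_union_null h1
    hΩ.spaceTime.volume_snd_image_horizontal_normal)
  rw [← image_union]
  refine image_mono ?_
  rintro p ⟨⟨hp, ht⟩, hpB⟩
  have hlat : p ∈ lateralBoundary T Ω := by
    refine ⟨ht.1, ?_⟩
    by_contra hx
    exact ht.2 ⟨ht.1, p.snd, by simpa using hp, hx⟩
  by_cases hv : ∃ v, IsNormalVelocityAt T Ω p.fst p.snd v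
  · right
    obtain ⟨v, hv⟩ := hv
    have hv0 : v = 0 := by
      by_contra hne
      exact hpB ⟨hp, ht, by rwa [hv.normalVelocity_eq]⟩
    obtain ⟨n, -, -, hn⟩ := hv
    refine ⟨n, ?_⟩
    rw [hv0, neg_zero] at hn
    simpa using hn
  · exact Or.inl fun h => hv (h hlat)

/-- Near a point of nonzero normal velocity `v` and normal `n`, the boundary is the graph of a
function of the space variable with derivative `⟪n, ·⟫ / v`. -/
theorem exists_hasFDerivWithinAt_of_moving (hG : IsOpen (spaceTimeDomain T Ω)) {p : SpaceTime d}
    (hp : p ∈ movingBoundary T Ω) :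
    ∃ L : Space d →L[ℝ] ℝ, |normalVelocity T Ω p.fst p.snd| * ‖L‖ = 1 ∧
      ∀ (f : Space d → ℝ) (K : ℝ≥0) (s : Set (Space d)), LipschitzWith K f → f p.snd = p.fst →
        (∀ y ∈ s, stPoint (f y) y ∈ frontier (spaceTimeDomain T Ω)) →
        HasFDerivWithinAt f L s p.snd := by
  obtain ⟨-, -, hv⟩ := hp
  set v := normalVelocity T Ω p.fst p.snd
  have hv' : 0 < |v| := abs_pos.2 hv
  obtain ⟨n, hn1, -, hn⟩ := isNormalVelocityAt_normalVelocity hv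
  refine ⟨v⁻¹ • innerSL ℝ n, ?_, fun f K s hf hfp hs => ?_⟩
  · rw [norm_smul, innerSL_apply_norm, hn1, mul_one, norm_inv, Real.norm_eq_abs,
      mul_inv_cancel₀ hv'.ne']
  rw [hasFDerivWithinAt_iff_isLittleO, Asymptotics.isLittleO_iff]
  intro ε hε
  have hγ : Tendsto (fun y => stPoint (f y) y) (𝓝[s] p.snd) (𝓝 p) := by
    have : Continuous fun y => stPoint (f y) y :=
      continuous_stPoint.comp (hf.continuous.prodMk continuous_id)
    have h := (this.tendsto p.snd).mono_left (nhdsWithin_le_nhds (s := s))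
    rw [hfp] at h
    exact h
  have hK : (0 : ℝ) < K + 1 := by positivity
  filter_upwards [hγ.eventually (hn.eventually_abs_inner_le hG
    (div_pos (mul_pos hε hv') hK)), self_mem_nhdsWithin] with y hy hys
  have hy := hy (hs y hys)
  rw [SpaceTime.inner_def] at hy
  have h1 : ‖stPoint (f y) y - stPoint p.fst p.snd‖ ≤ (K + 1) * ‖y - p.snd‖ := by
    refine (SpaceTime.norm_le _).trans ?_
    have := hf.dist_le_mul y p.snd
    rw [hfp, Real.dist_eq, dist_eq_norm] at this
    have h2 : |(stPoint (f y) y - stPoint p.fst p.snd).fst| ≤ K * ‖y - p.snd‖ := this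
    have h3 : ‖(stPoint (f y) y - stPoint p.fst p.snd).snd‖ = ‖y - p.snd‖ := rfl
    linarith
  have h4 : f y - f p.snd - (v⁻¹ • innerSL ℝ n) (y - p.snd) =
      -(v⁻¹ * ((stPoint (f y) y - stPoint p.fst p.snd).fst * (stPoint (-v) n).fst +
        inner ℝ (stPoint (f y) y - stPoint p.fst p.snd).snd (stPoint (-v) n).snd)) := by
    have : (v⁻¹ • innerSL ℝ n) (y - p.snd) = v⁻¹ * inner ℝ (y - p.snd) n := by
      rw [real_inner_comm]; rfl
    rw [this, hfp]
    simp only [WithLp.sub_fst, WithLp.sub_snd, stPoint_fst, stPoint_snd]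
    field_simp
    ring
  have hy' : |(stPoint (f y) y - stPoint p.fst p.snd).fst * (stPoint (-v) n).fst +
        inner ℝ (stPoint (f y) y - stPoint p.fst p.snd).snd (stPoint (-v) n).snd| ≤
      ε * |v| / (K + 1) * ((K + 1) * ‖y - p.snd‖) :=
    hy.trans (by gcongr)
  rw [h4, norm_neg, norm_mul, norm_inv, Real.norm_eq_abs, Real.norm_eq_abs]
  calc _ ≤ |v|⁻¹ * (ε * |v| / (K + 1) * ((K + 1) * ‖y - p.snd‖)) := by gcongr
    _ = ε * ‖y - p.snd‖ := by field_simp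

end Velocity

section Pieces

variable {d : ℕ}

/-- The points of `M` at which `M` satisfies a cone condition of aperture `k` at scale `k⁻¹`. On a
part of this set of diameter less than `k⁻¹`, time is a `k`-Lipschitz function of space. -/
def conePoints (M : Set (SpaceTime d)) (k : ℝ) : Set (SpaceTime d) :=
  {p | p ∈ M ∧ ∀ q ∈ M, dist q p < k⁻¹ → |q.fst - p.fst| ≤ k * ‖q.snd - p.snd‖}

theorem isClosed_conePoints {M : Set (SpaceTime d)} (hM : IsClosed M) (k : ℝ) :
    IsClosed (conePoints M k) := by
  have : conePoints M k = M ∩ ⋂ q ∈ M, ({p | k⁻¹ ≤ dist q p} ∪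
      {p | |q.fst - p.fst| ≤ k * ‖q.snd - p.snd‖}) := by
    ext p
    simp only [conePoints, mem_ofPred_eq, mem_inter_iff, mem_iInter, mem_union]
    refine and_congr_right fun _ => forall₂_congr fun q _ => ?_
    rw [imp_iff_not_or, not_lt]
  rw [this]
  have hf : Continuous fun p : SpaceTime d => p.fst := SpaceTime.lipschitzWith_fst.continuous
  have hs : Continuous fun p : SpaceTime d => p.snd := SpaceTime.lipschitzWith_snd.continuous
  refine hM.inter (isClosed_biInter fun q _ => IsClosed.union ?_ ?_)
  · exact isClosed_le continuous_const (by fun_prop)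
  · exact isClosed_le (by fun_prop) (by fun_prop)

theorem exists_mem_conePoints_of_moving {T : ℝ} {Ω : ℝ → Set (Space d)}
    (hG : IsOpen (spaceTimeDomain T Ω)) {p : SpaceTime d} (hp : p ∈ movingBoundary T Ω) :
    ∃ k : ℕ, p ∈ conePoints (frontier (spaceTimeDomain T Ω)) (k + 1) := by
  obtain ⟨hpM, -, hv⟩ := hp
  set v := normalVelocity T Ω p.fst p.snd
  have hv' : 0 < |v| := abs_pos.2 hv
  obtain ⟨n, hn1, -, hn⟩ := isNormalVelocityAt_normalVelocity hv
  obtain ⟨δ, hδ, h⟩ := Metric.eventually_nhds_iff.1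
    (hn.eventually_abs_inner_le hG (half_pos hv'))
  obtain ⟨k, hk⟩ := exists_nat_gt (max δ⁻¹ ((1 + |v| / 2) / (|v| / 2)))
  have hk0 : (0 : ℝ) < k + 1 := by positivity
  refine ⟨k, hpM, fun q hq hqp => ?_⟩
  have hδk : (k + 1 : ℝ)⁻¹ < δ := by
    rw [inv_lt_comm₀ hk0 hδ]
    linarith [le_max_left δ⁻¹ ((1 + |v| / 2) / (|v| / 2))]
  have h1 := h (hqp.trans hδk) hq
  rw [SpaceTime.inner_def] at h1
  have h2 : |(q.fst - p.fst) * (-v)| ≤ |v| / 2 * ‖q - p‖ + ‖q.snd - p.snd‖ := by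
    have h3 : |inner ℝ (q.snd - p.snd) n| ≤ ‖q.snd - p.snd‖ := by
      simpa [hn1] using abs_real_inner_le_norm (q.snd - p.snd) n
    have h4 : (q.fst - p.fst) * (-v) = ((q.fst - p.fst) * (-v) + inner ℝ (q.snd - p.snd) n) -
        inner ℝ (q.snd - p.snd) n := by ring
    rw [h4]
    refine (abs_sub _ _).trans (add_le_add h1 h3)
  rw [abs_mul, abs_neg] at h2
  have h5 : ‖q - p‖ ≤ |q.fst - p.fst| + ‖q.snd - p.snd‖ := SpaceTime.norm_le (q - p)
  have h6 : |v| / 2 * |q.fst - p.fst| ≤ (1 + |v| / 2) * ‖q.snd - p.snd‖ := by nlinarith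
  have h7 : |q.fst - p.fst| ≤ (1 + |v| / 2) / (|v| / 2) * ‖q.snd - p.snd‖ := by
    rw [div_mul_eq_mul_div, le_div_iff₀ (half_pos hv')]
    linarith
  refine h7.trans ?_
  gcongr
  linarith [le_max_right δ⁻¹ ((1 + |v| / 2) / (|v| / 2))]

theorem exists_lipschitz_graph {K : Set (SpaceTime d)} {k : ℝ≥0}
    (h : ∀ p ∈ K, ∀ q ∈ K, |q.fst - p.fst| ≤ k * ‖q.snd - p.snd‖) :
    ∃ f : Space d → ℝ, LipschitzWith k f ∧ ∀ p ∈ K, f p.snd = p.fst := by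
  classical
  have hinj : InjOn (fun p : SpaceTime d => p.snd) K := by
    intro p hp q hq hpq
    have h1 := h p hp q hq
    simp only at hpq
    rw [hpq, sub_self, norm_zero, mul_zero, abs_nonpos_iff, sub_eq_zero] at h1
    rw [← stPoint_fst_snd p, ← stPoint_fst_snd q, hpq, h1]
  set g : Space d → ℝ := fun x => (Function.invFunOn (fun p : SpaceTime d => p.snd) K x).fst
  have hg : ∀ p ∈ K, g p.snd = p.fst := fun p hp =>
    congrArg (fun q : SpaceTime d => q.fst) (hinj.leftInvOn_invFunOn hp)
  have hL : LipschitzOnWith k g ((fun p : SpaceTime d => p.snd) '' K) := by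
    refine LipschitzOnWith.of_dist_le_mul ?_
    rintro _ ⟨p, hp, rfl⟩ _ ⟨q, hq, rfl⟩
    simp only
    rw [hg p hp, hg q hq, Real.dist_eq, dist_eq_norm]
    exact h q hq p hp
  obtain ⟨f, hf, hfg⟩ := hL.extend_real
  exact ⟨f, hf, fun p hp => by rw [← hfg ⟨p, hp, rfl⟩, hg p hp]⟩

end Pieces

/-! ### Decomposition of the moving boundary into graphs -/

/-- A measurable decomposition of the moving part of the boundary, up to an `ℋ^d`-null set, into
graphs `{(f i x, x) | x ∈ s i}` over space, with derivatives `f' i` and with normal velocities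
`v i`. -/
structure IsGraphDecomposition {d : ℕ} (T : ℝ) (Ω : ℝ → Set (Space d)) (s : ℕ → Set (Space d))
    (f : ℕ → Space d → ℝ) (f' : ℕ → Space d → Space d →L[ℝ] ℝ) (v : ℕ → Space d → ℝ) : Prop where
  measurableSet : ∀ i, MeasurableSet (s i)
  continuous : ∀ i, Continuous (f i)
  hasFDerivWithinAt : ∀ i, ∀ x ∈ s i, HasFDerivWithinAt (f i) (f' i x) (s i) x
  measurable : ∀ i, Measurable (v i)
  velocity : ∀ i, ∀ x ∈ s i, normalVelocity T Ω (f i x) x = v i x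
  abs_mul_norm : ∀ i, ∀ x ∈ s i, |v i x| * ‖f' i x‖ = 1
  mem : ∀ i, ∀ x ∈ s i, stPoint (f i x) x ∈ movingBoundary T Ω
  injective : ∀ i j x, x ∈ s i → x ∈ s j → f i x = f j x → i = j
  null : μHE[d] (movingBoundary T Ω \ {p | ∃ i, p.snd ∈ s i ∧ f i p.snd = p.fst}) = 0

theorem aemeasurable_norm_of_hasFDerivWithinAt {V : Type*} [NormedAddCommGroup V]
    [NormedSpace ℝ V] [MeasurableSpace V] [BorelSpace V] [FiniteDimensional ℝ V]
    (μ : Measure V) [μ.IsAddHaarMeasure] {s : Set V} (hs : MeasurableSet s) {f : V → ℝ}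
    {f' : V → V →L[ℝ] ℝ} (hf : ∀ x ∈ s, HasFDerivWithinAt f (f' x) s x) :
    AEMeasurable (fun x => ‖f' x‖) (μ.restrict s) := by
  rcases subsingleton_or_nontrivial V with hV | hV
  · have : (fun x => ‖f' x‖) = fun _ => 0 := by
      ext x
      rw [Subsingleton.elim (f' x) 0, norm_zero]
    rw [this]
    exact aemeasurable_const
  · -- Mathlib's measurability lemma concerns maps of `V` to itself: `f` is composed with an
    -- isometric embedding of the line.
    obtain ⟨y, hy⟩ := exists_ne (0 : V)
    have ne : ‖‖y‖⁻¹ • y‖ = 1 := norm_smul_inv_norm (𝕜 := ℝ) hy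
    have h := (aemeasurable_fderivWithin μ hs (f := fun x => f x • (‖y‖⁻¹ • y))
      (f' := fun x => (f' x).smulRight (‖y‖⁻¹ • y)) fun x hx => (hf x hx).smul_const _).norm
    simpa only [ContinuousLinearMap.norm_smulRight_apply, ne, mul_one] using h

/-- The moving boundary is cut into countably many disjoint pieces on which the boundary satisfies a
uniform cone condition, hence is a Lipschitz graph over space. From the projections of the pieces,
null sets are removed on which points of zero velocity project or measurability fails. -/
theorem IsMovingDomain.exists_isGraphDecomposition {d : ℕ} {T : ℝ} {Ω : ℝ → Set (Space d)}
    (hΩ : IsMovingDomain T Ω) : ∃ s f f' v, IsGraphDecomposition T Ω s f f' v := by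
  classical
  have hG := hΩ.spaceTime
  have hM : IsClosed (frontier (spaceTimeDomain T Ω)) := isClosed_frontier
  -- countably many closed sets that are Lipschitz graphs and cover the moving boundary
  set K : ℕ → Set (SpaceTime d) := fun n =>
    conePoints (frontier (spaceTimeDomain T Ω)) ((Nat.unpair n).1 + 1) ∩
      Metric.closedBall (TopologicalSpace.denseSeq (SpaceTime d) (Nat.unpair n).2)
        (((Nat.unpair n).1 + 1 : ℝ)⁻¹ / 3) with hK
  have hKc : ∀ n, IsClosed (K n) := fun n =>
    (isClosed_conePoints hM _).inter Metric.isClosed_closedBall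
  have hKM : ∀ n, K n ⊆ frontier (spaceTimeDomain T Ω) := fun n p hp => hp.1.1
  have hcover : movingBoundary T Ω ⊆ ⋃ n, K n := by
    intro p hp
    obtain ⟨k, hk⟩ := exists_mem_conePoints_of_moving hG.isOpen hp
    have hpos : (0 : ℝ) < (k + 1 : ℝ)⁻¹ / 3 := by positivity
    obtain ⟨j, hj⟩ := (TopologicalSpace.denseRange_denseSeq (SpaceTime d)).exists_dist_lt p hpos
    refine mem_iUnion.2 ⟨Nat.pair k j, ?_⟩
    simp only [hK, Nat.unpair_pair]
    exact ⟨hk, hj.le⟩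
  have hgraph : ∀ n, ∃ (k : ℝ≥0) (f : Space d → ℝ), LipschitzWith k f ∧
      ∀ p ∈ K n, f p.snd = p.fst := by
    intro n
    obtain ⟨f, hf⟩ := exists_lipschitz_graph (K := K n) (k := (Nat.unpair n).1 + 1) (by
      intro p hp q hq
      refine (hp.1.2 q hq.1.1 ?_).trans_eq (by push_cast; rfl)
      have h1 : (0 : ℝ) < ((Nat.unpair n).1 + 1 : ℝ)⁻¹ := by positivity
      have h2 := Metric.mem_closedBall.1 hp.2
      have h3 := Metric.mem_closedBall.1 hq.2
      have h4 := dist_triangle_right q p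
        (TopologicalSpace.denseSeq (SpaceTime d) (Nat.unpair n).2)
      linarith)
    exact ⟨_, f, hf⟩
  choose k f hfL hfK using hgraph
  have hγL : ∀ n, LipschitzWith (k n + 1) fun x => stPoint (f n x) x := fun n =>
    LipschitzWith.of_dist_le_mul fun x y => by
      have h1 := (hfL n).dist_le_mul x y
      have h2 := SpaceTime.norm_le (stPoint (f n x) x - stPoint (f n y) y)
      simp only [WithLp.sub_fst, WithLp.sub_snd, stPoint_fst, stPoint_snd] at h2
      rw [Real.dist_eq, dist_eq_norm] at h1
      rw [dist_eq_norm, dist_eq_norm]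
      push_cast
      linarith
  set A : ℕ → Set (SpaceTime d) := disjointed K with hA
  have hAm : ∀ n, MeasurableSet (A n) := fun n =>
    MeasurableSet.disjointed (fun n => (hKc n).measurableSet) n
  set D : Set (SpaceTime d) := {p | p ∈ frontier (spaceTimeDomain T Ω) ∧
      p.fst ∈ Ioo 0 T \ jumpTimes T Ω} with hD
  have hDm : MeasurableSet D := hM.measurableSet.inter
    (SpaceTime.lipschitzWith_fst.continuous.measurable
      (measurableSet_Ioo.diff hG.countable_jumpTimes.measurableSet))
  set Z : Set (Space d) := toMeasurable volume
    ((fun p : SpaceTime d => p.snd) '' (D \ movingBoundary T Ω)) with hZ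
  have hZ0 : volume Z = 0 := by
    rw [hZ, measure_toMeasurable]
    exact hΩ.volume_snd_image_not_moving
  set s₁ : ℕ → Set (Space d) := fun n => (fun x => stPoint (f n x) x) ⁻¹' (A n ∩ D) \ Z with hs₁
  have hs₁m : ∀ n, MeasurableSet (s₁ n) := fun n =>
    ((hγL n).continuous.measurable ((hAm n).inter hDm)).diff (measurableSet_toMeasurable _ _)
  have hs₁B : ∀ n, ∀ x ∈ s₁ n, stPoint (f n x) x ∈ movingBoundary T Ω := by
    intro n x hx
    by_contra hB
    exact hx.2 (subset_toMeasurable _ _ ⟨_, ⟨hx.1.2, hB⟩, rfl⟩)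
  have hder : ∀ n x, ∃ L : Space d →L[ℝ] ℝ, x ∈ s₁ n →
      |normalVelocity T Ω (f n x) x| * ‖L‖ = 1 ∧ HasFDerivWithinAt (f n) L (s₁ n) x := by
    intro n x
    by_cases hx : x ∈ s₁ n
    · obtain ⟨L, hL, h⟩ := exists_hasFDerivWithinAt_of_moving hG.isOpen (hs₁B n x hx)
      exact ⟨L, fun _ => ⟨hL, h (f n) (k n) (s₁ n) (hfL n) rfl fun y hy => (hs₁B n y hy).1⟩⟩
    · exact ⟨0, fun h => absurd h hx⟩
  choose f' hf' using hder
  have hae := fun n => aemeasurable_norm_of_hasFDerivWithinAt volume (hs₁m n)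
    fun x hx => (hf' n x hx).2
  set w : ℕ → Space d → ℝ := fun n => (hae n).mk with hw
  have hwm : ∀ n, Measurable (w n) := fun n => (hae n).measurable_mk
  set E : ℕ → Set (Space d) := fun n =>
    toMeasurable volume {x | x ∈ s₁ n ∧ ‖f' n x‖ ≠ w n x} with hE
  have hE0 : ∀ n, volume (E n) = 0 := fun n => by
    rw [hE, measure_toMeasurable]
    have h := ae_iff.1 ((ae_restrict_iff' (hs₁m n)).1 (hae n).ae_eq_mk)
    simpa only [Classical.not_imp] using h
  -- The sign of the velocity is measurable: it is positive where the time line enters the domain.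
  set P : Set (SpaceTime d) :=
    {p | ∃ m : ℕ, ∀ j ≥ m, stPoint (p.fst + 1 / ((j : ℝ) + 1)) p.snd ∈ spaceTimeDomain T Ω} with hP
  have hPm : MeasurableSet P := by
    have : P = ⋃ m : ℕ, ⋂ j : ℕ, ⋂ _ : j ≥ m,
        (fun p : SpaceTime d => stPoint (p.fst + 1 / ((j : ℝ) + 1)) p.snd) ⁻¹'
          spaceTimeDomain T Ω := by
      ext p; simp [hP]
    rw [this]
    refine MeasurableSet.iUnion fun m => MeasurableSet.iInter fun j => MeasurableSet.iInter
      fun _ => (hG.isOpen.preimage ?_).measurableSet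
    exact continuous_stPoint.comp
      ((SpaceTime.lipschitzWith_fst.continuous.add continuous_const).prodMk
        SpaceTime.lipschitzWith_snd.continuous)
  have hPiff : ∀ p ∈ movingBoundary T Ω, p ∈ P ↔ 0 < normalVelocity T Ω p.fst p.snd := by
    intro p hp
    have hlim : Tendsto (fun j : ℕ => p.fst + 1 / ((j : ℝ) + 1)) atTop (𝓝 p.fst) := by
      simpa using tendsto_one_div_add_atTop_nhds_zero_nat.const_add p.fst
    have hcr := hlim.eventually
      ((isNormalVelocityAt_normalVelocity hp.2.2).eventually_crossing hp.2.2)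
    obtain ⟨m, hm⟩ := eventually_atTop.1 hcr
    have hpos : ∀ j : ℕ, (0 : ℝ) < 1 / ((j : ℝ) + 1) := fun j => by positivity
    constructor
    · rintro ⟨m', hm'⟩
      by_contra hle
      have hneg : normalVelocity T Ω p.fst p.snd < 0 := lt_of_le_of_ne (not_lt.1 hle) hp.2.2
      refine (hm (max m m') (le_max_left _ _)).2 ?_ (hm' _ (le_max_right _ _))
      rw [add_sub_cancel_left]
      exact mul_neg_of_pos_of_neg (hpos _) hneg
    · intro hv
      refine ⟨m, fun j hj => (hm j hj).1 ?_⟩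
      rw [add_sub_cancel_left]
      exact mul_pos (hpos _) hv
  refine ⟨fun n => s₁ n \ E n, f, f', fun n x =>
    (if stPoint (f n x) x ∈ P then 1 else -1) * (w n x)⁻¹, ?_⟩
  have hs₁w : ∀ n, ∀ x ∈ s₁ n \ E n, ‖f' n x‖ = w n x := by
    intro n x hx
    by_contra hne
    exact hx.2 (subset_toMeasurable _ _ ⟨hx.1, hne⟩)
  have hvel : ∀ n, ∀ x ∈ s₁ n \ E n, normalVelocity T Ω (f n x) x =
      (if stPoint (f n x) x ∈ P then 1 else -1) * (w n x)⁻¹ := by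
    intro n x hx
    have h1 := (hf' n x hx.1).1
    rw [hs₁w n x hx] at h1
    have h2 := eq_inv_of_mul_eq_one_left h1
    have h3 := hPiff _ (hs₁B n x hx.1)
    simp only [stPoint_fst, stPoint_snd] at h3
    split_ifs with hxP
    · rw [← h2, abs_of_pos (h3.1 hxP), one_mul]
    · rw [← h2, abs_of_nonpos (not_lt.1 fun h => hxP (h3.2 h))]
      ring
  exact
  { measurableSet := fun n => (hs₁m n).diff (measurableSet_toMeasurable _ _)
    continuous := fun n => (hfL n).continuous
    hasFDerivWithinAt := fun n x hx => (hf' n x hx.1).2.mono sdiff_subset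
    measurable := fun n => by
      refine Measurable.mul ?_ (hwm n).inv
      exact Measurable.ite ((hγL n).continuous.measurable hPm) measurable_const measurable_const
    velocity := hvel
    abs_mul_norm := fun n x hx => by
      rw [← hvel n x hx]
      exact (hf' n x hx.1).1
    mem := fun n x hx => hs₁B n x hx.1
    injective := fun i j x hi hj hij => by
      by_contra hne
      have h1 := hi.1.1.1
      have h2 := hj.1.1.1
      simp only [hij] at h1
      exact disjoint_left.1 (disjoint_disjointed K hne) h1 h2
    null := by
      have hsub : movingBoundary T Ω \ {p | ∃ i, p.snd ∈ s₁ i \ E i ∧ f i p.snd = p.fst} ⊆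
          ⋃ n, (fun x => stPoint (f n x) x) '' (Z ∪ E n) := by
        rintro p ⟨hpB, hp⟩
        have hpA : p ∈ ⋃ n, A n := by
          rw [hA, iUnion_disjointed]
          exact hcover hpB
        obtain ⟨n, hn⟩ := mem_iUnion.1 hpA
        have hfp := hfK n p (disjointed_subset K n hn)
        have hpe : stPoint (f n p.snd) p.snd = p := by rw [hfp, stPoint_fst_snd]
        refine mem_iUnion.2 ⟨n, p.snd, ?_, hpe⟩
        by_contra hnot
        rw [mem_union, not_or] at hnot
        refine hp ⟨n, ⟨⟨?_, hnot.1⟩, hnot.2⟩, hfp⟩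
        simp only [mem_preimage, hpe]
        exact ⟨hn, hpB.1, hpB.2.1⟩
      refine measure_mono_null hsub (measure_iUnion_null fun n => ?_)
      refine (hγL n).euclideanHausdorffMeasure_image_eq_zero ?_
      rw [EuclideanSpace.euclideanHausdorffMeasure_eq_volume]
      exact measure_union_null hZ0 (hE0 n) }

/-! ### Jumps along a line -/

section Line

open Classical in
/-- The value on the right of `t` of the function equal to `w` on `O` and to zero off `O`. -/
noncomputable def rightValue (O : Set ℝ) (w : ℝ → ℝ) (t : ℝ) : ℝ :=
  if ∀ᶠ τ in 𝓝[>] t, τ ∈ O then w t else 0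

open Classical in
/-- The value on the left of `t` of the function equal to `w` on `O` and to zero off `O`. -/
noncomputable def leftValue (O : Set ℝ) (w : ℝ → ℝ) (t : ℝ) : ℝ :=
  if ∀ᶠ τ in 𝓝[<] t, τ ∈ O then w t else 0

variable {O : Set ℝ} {w w' : ℝ → ℝ}

theorem abs_rightValue_le {t C : ℝ} (hC : ∀ τ ∈ closure O, |w τ| ≤ C) (hC0 : 0 ≤ C) :
    |rightValue O w t| ≤ C := by
  unfold rightValue
  split_ifs with h
  · refine hC t ?_
    rw [mem_closure_iff_frequently]
    exact h.frequently.filter_mono nhdsWithin_le_nhds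
  · simpa using hC0

theorem abs_leftValue_le {t C : ℝ} (hC : ∀ τ ∈ closure O, |w τ| ≤ C) (hC0 : 0 ≤ C) :
    |leftValue O w t| ≤ C := by
  unfold leftValue
  split_ifs with h
  · refine hC t ?_
    rw [mem_closure_iff_frequently]
    exact h.frequently.filter_mono nhdsWithin_le_nhds
  · simpa using hC0

theorem rightValue_eq_zero_of_eventually_notMem {t : ℝ} (h : ∀ᶠ τ in 𝓝[>] t, τ ∉ O) :
    rightValue O w t = 0 := if_neg fun h' => by
  obtain ⟨τ, h1, h2⟩ := (h'.and h).exists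
  exact h2 h1

theorem leftValue_eq_zero_of_eventually_notMem {t : ℝ} (h : ∀ᶠ τ in 𝓝[<] t, τ ∉ O) :
    leftValue O w t = 0 := if_neg fun h' => by
  obtain ⟨τ, h1, h2⟩ := (h'.and h).exists
  exact h2 h1

theorem one_sided_values_eq_of_notMem_frontier (hO : IsOpen O) {t : ℝ} (ht : t ∉ frontier O) :
    rightValue O w t = O.indicator w t ∧ leftValue O w t = O.indicator w t := by
  by_cases hmem : t ∈ O
  · have h := hO.mem_nhds hmem
    rw [indicator_of_mem hmem]
    exact ⟨if_pos (nhdsWithin_le_nhds h), if_pos (nhdsWithin_le_nhds h)⟩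
  · have hcl : t ∉ closure O := fun h => ht (by rw [hO.frontier_eq]; exact ⟨h, hmem⟩)
    have h : ∀ᶠ τ in 𝓝 t, τ ∉ O := by
      filter_upwards [isClosed_closure.isOpen_compl.mem_nhds hcl] with τ hτ h'
      exact hτ (subset_closure h')
    rw [indicator_of_notMem hmem]
    exact ⟨rightValue_eq_zero_of_eventually_notMem (nhdsWithin_le_nhds h),
      leftValue_eq_zero_of_eventually_notMem (nhdsWithin_le_nhds h)⟩

theorem leftValue_sub_rightValue_of_no_frontier (hO : IsOpen O) (hw : ContinuousOn w (closure O))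
    (hw' : ∀ τ ∈ O, HasDerivAt w (w' τ) τ)
    (hint : ∀ a b, IntervalIntegrable (O.indicator w') volume a b) {a b : ℝ} (hab : a < b)
    (hZ : Disjoint (frontier O) (Ioo a b)) :
    leftValue O w b - rightValue O w a = ∫ τ in a..b, O.indicator w' τ := by
  have hcov : Ioo a b ⊆ O ∪ (closure O)ᶜ := by
    intro τ hτ
    by_contra h
    rw [mem_union, not_or, mem_compl_iff, not_not] at h
    exact disjoint_left.1 hZ (by rw [hO.frontier_eq]; exact ⟨h.2, h.1⟩) hτ
  have hra : Ioo a b ∈ 𝓝[>] a := Ioo_mem_nhdsGT hab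
  have hlb : Ioo a b ∈ 𝓝[<] b := Ioo_mem_nhdsLT hab
  rcases isPreconnected_iff_subset_of_disjoint.1 isPreconnected_Ioo O (closure O)ᶜ hO
    isClosed_closure.isOpen_compl hcov (by
      ext τ
      simp only [mem_inter_iff, mem_compl_iff, mem_empty_iff_false, iff_false]
      rintro ⟨-, h1, h2⟩
      exact h2 (subset_closure h1)) with hin | hout
  · have hl : ∀ᶠ τ in 𝓝[<] b, τ ∈ O := mem_of_superset hlb hin
    have hr : ∀ᶠ τ in 𝓝[>] a, τ ∈ O := mem_of_superset hra hin
    rw [leftValue, rightValue, if_pos hl, if_pos hr]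
    refine (intervalIntegral.integral_eq_sub_of_hasDerivAt_of_le hab.le (hw.mono ?_)
      (fun τ hτ => ?_) (hint a b)).symm
    · rw [← closure_Ioo hab.ne]
      exact closure_mono hin
    · rw [indicator_of_mem (hin hτ)]
      exact hw' τ (hin hτ)
  · have hn : ∀ τ ∈ Ioo a b, τ ∉ O := fun τ hτ h => hout hτ (subset_closure h)
    rw [leftValue_eq_zero_of_eventually_notMem (mem_of_superset hlb hn),
      rightValue_eq_zero_of_eventually_notMem (mem_of_superset hra hn)]
    refine (intervalIntegral.integral_eq_sub_of_hasDerivAt_of_le (f := fun _ => 0) hab.le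
      continuousOn_const (fun τ hτ => ?_) (hint a b)).symm
    rw [indicator_of_notMem (hn τ hτ)]
    exact hasDerivAt_const τ 0

/-- The fundamental theorem of calculus for a function that is `C¹` on an open set of the line and
zero off it, when the boundary of the set is finite. -/
theorem leftValue_sub_rightValue_eq (hO : IsOpen O) (hw : ContinuousOn w (closure O))
    (hw' : ∀ τ ∈ O, HasDerivAt w (w' τ) τ)
    (hint : ∀ a b, IntervalIntegrable (O.indicator w') volume a b) (Z : Finset ℝ) {a b : ℝ}
    (hab : a < b) (hZ : frontier O ∩ Ioo a b ⊆ Z) :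
    leftValue O w b - rightValue O w a = (∫ τ in a..b, O.indicator w' τ) +
      ∑ τ ∈ Z with τ ∈ Ioo a b, (rightValue O w τ - leftValue O w τ) := by
  classical
  induction hn : (Z.filter (· ∈ Ioo a b)).card using Nat.strong_induction_on generalizing a b with
  | _ n ih =>
    rcases (Z.filter (· ∈ Ioo a b)).eq_empty_or_nonempty with he | ⟨c, hc⟩
    · rw [he, Finset.sum_empty, add_zero]
      refine leftValue_sub_rightValue_of_no_frontier hO hw hw' hint hab ?_
      rw [disjoint_left]
      intro τ h1 h2
      have : τ ∈ Z.filter (· ∈ Ioo a b) := Finset.mem_filter.2 ⟨hZ ⟨h1, h2⟩, h2⟩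
      rw [he] at this
      exact absurd this (Finset.notMem_empty τ)
    · obtain ⟨hcZ, hac, hcb⟩ := Finset.mem_filter.1 hc
      have hsplit : Z.filter (· ∈ Ioo a b) =
          insert c (Z.filter (· ∈ Ioo a c) ∪ Z.filter (· ∈ Ioo c b)) := by
        ext τ
        simp only [Finset.mem_filter, Finset.mem_insert, Finset.mem_union, mem_Ioo]
        constructor
        · rintro ⟨h1, h2, h3⟩
          rcases lt_trichotomy τ c with h | h | h
          · exact Or.inr (Or.inl ⟨h1, h2, h⟩)
          · exact Or.inl h
          · exact Or.inr (Or.inr ⟨h1, h, h3⟩)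
        · rintro (rfl | ⟨h1, h2, h3⟩ | ⟨h1, h2, h3⟩)
          · exact ⟨hcZ, hac, hcb⟩
          · exact ⟨h1, h2, h3.trans hcb⟩
          · exact ⟨h1, hac.trans h2, h3⟩
      have hnot : c ∉ Z.filter (· ∈ Ioo a c) ∪ Z.filter (· ∈ Ioo c b) := by
        simp
      have hdisj : Disjoint (Z.filter (· ∈ Ioo a c)) (Z.filter (· ∈ Ioo c b)) := by
        rw [Finset.disjoint_left]
        intro τ h1 h2
        exact lt_asymm (Finset.mem_filter.1 h1).2.2 (Finset.mem_filter.1 h2).2.1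
      have hcard : (Z.filter (· ∈ Ioo a b)).card =
          (Z.filter (· ∈ Ioo a c)).card + (Z.filter (· ∈ Ioo c b)).card + 1 := by
        rw [hsplit, Finset.card_insert_of_notMem hnot, Finset.card_union_of_disjoint hdisj]
      have h1 := ih _ (by omega) hac (fun τ hτ => hZ ⟨hτ.1, hτ.2.1, hτ.2.2.trans hcb⟩) rfl
      have h2 := ih _ (by omega) hcb (fun τ hτ => hZ ⟨hτ.1, hac.trans hτ.2.1, hτ.2.2⟩) rfl
      rw [hsplit, Finset.sum_insert hnot, Finset.sum_union hdisj,
        ← intervalIntegral.integral_add_adjacent_intervals (hint a c) (hint c b)]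
      linarith

/-- The increment of a function that is `C¹` on an open set of the line and zero off it, up to an
error counting the exceptional boundary points `ZN`, when the jumps at the other boundary points
`ZB` are known. The exceptional points cost at most `2 * C` each in the sum of the jumps, and as
much again at each of the two end points of the interval. -/
theorem abs_increment_sub_le (hO : IsOpen O) (hw : ContinuousOn w (closure O))
    (hw' : ∀ τ ∈ O, HasDerivAt w (w' τ) τ)
    (hint : ∀ a b, IntervalIntegrable (O.indicator w') volume a b) {C : ℝ} (hC0 : 0 ≤ C)
    (hC : ∀ τ ∈ closure O, |w τ| ≤ C) (ZN ZB : Finset ℝ) (hNB : Disjoint ZN ZB) {a b : ℝ}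
    (hab : a < b) (hZ : frontier O ∩ Icc a b ⊆ ZN ∪ ZB) (ha : a ∉ ZB) (hb : b ∉ ZB)
    {j : ℝ → ℝ} (hj : ∀ τ ∈ ZB, τ ∈ Ioo a b → rightValue O w τ - leftValue O w τ = j τ) :
    |O.indicator w b - O.indicator w a - (∫ τ in a..b, O.indicator w' τ) -
      ∑ τ ∈ ZB with τ ∈ Ioo a b, j τ| ≤ 6 * C * (ZN.filter (· ∈ Icc a b)).card := by
  classical
  have hmain := leftValue_sub_rightValue_eq hO hw hw' hint (ZN ∪ ZB) hab (fun τ hτ => by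
    rw [Finset.coe_union]
    exact hZ ⟨hτ.1, Ioo_subset_Icc_self hτ.2⟩)
  rw [Finset.filter_union, Finset.sum_union (Finset.disjoint_filter_filter hNB)] at hmain
  have hB : ∑ τ ∈ ZB with τ ∈ Ioo a b, (rightValue O w τ - leftValue O w τ) =
      ∑ τ ∈ ZB with τ ∈ Ioo a b, j τ :=
    Finset.sum_congr rfl fun τ hτ =>
      hj τ (Finset.mem_filter.1 hτ).1 (Finset.mem_filter.1 hτ).2
  rw [hB] at hmain
  set k : ℕ := (ZN.filter (· ∈ Icc a b)).card with hk
  have hsub : ZN.filter (· ∈ Ioo a b) ⊆ ZN.filter (· ∈ Icc a b) := fun τ hτ => by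
    rw [Finset.mem_filter] at hτ ⊢
    exact ⟨hτ.1, Ioo_subset_Icc_self hτ.2⟩
  have hsum : |∑ τ ∈ ZN with τ ∈ Ioo a b, (rightValue O w τ - leftValue O w τ)| ≤ 2 * C * k := by
    refine (Finset.abs_sum_le_sum_abs _ _).trans ?_
    refine (Finset.sum_le_card_nsmul _ _ (2 * C) fun τ _ => ?_).trans ?_
    · refine (abs_sub _ _).trans ?_
      linarith [abs_rightValue_le (t := τ) hC hC0, abs_leftValue_le (t := τ) hC hC0]
    · rw [nsmul_eq_mul, mul_comm]
      gcongr
      exact Finset.card_le_card hsub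
  have hind : ∀ τ, |O.indicator w τ| ≤ C := fun τ => by
    by_cases h : τ ∈ O
    · rw [indicator_of_mem h]; exact hC τ (subset_closure h)
    · rw [indicator_of_notMem h]; simpa using hC0
  have hend : ∀ τ ∈ Icc a b, τ ∉ ZB → τ ∈ frontier O → (1 : ℝ) ≤ k := by
    intro τ hτ hτB hτf
    have hτN : τ ∈ ZN := by
      rcases hZ ⟨hτf, hτ⟩ with h | h
      · exact h
      · exact absurd h hτB
    have : 0 < k := Finset.card_pos.2 ⟨τ, Finset.mem_filter.2 ⟨hτN, hτ⟩⟩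
    exact_mod_cast this
  have hk0 : (0 : ℝ) ≤ k := Nat.cast_nonneg k
  have hbE : |O.indicator w b - leftValue O w b| ≤ 2 * C * k := by
    by_cases hbf : b ∈ frontier O
    · have := hend b (right_mem_Icc.2 hab.le) hb hbf
      refine (abs_sub _ _).trans ?_
      nlinarith [hind b, abs_leftValue_le (t := b) hC hC0]
    · rw [(one_sided_values_eq_of_notMem_frontier hO hbf).2, sub_self, abs_zero]
      positivity
  have haE : |O.indicator w a - rightValue O w a| ≤ 2 * C * k := by
    by_cases haf : a ∈ frontier O
    · have := hend a (left_mem_Icc.2 hab.le) ha haf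
      refine (abs_sub _ _).trans ?_
      nlinarith [hind a, abs_rightValue_le (t := a) hC hC0]
    · rw [(one_sided_values_eq_of_notMem_frontier hO haf).1, sub_self, abs_zero]
      positivity
  rw [abs_le] at hsum hbE haE ⊢
  constructor <;> linarith [hsum.1, hsum.2, hbE.1, hbE.2, haE.1, haE.2]

end Line

/-! ### The surface integral as a sum over crossings -/

/-- Integration of a real function against a mixture of measures. -/
theorem integral_bind_of_integrable {α β : Type*} [MeasurableSpace α] [MeasurableSpace β]
    {m : Measure α} {κ : α → Measure β} (hκ : Measurable κ) {g : β → ℝ} (hg : Measurable g)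
    (hint : Integrable g (m.bind κ)) :
    (∀ᵐ a ∂m, Integrable g (κ a)) ∧ Integrable (fun a => ∫ y, g y ∂(κ a)) m ∧
      ∫ y, g y ∂(m.bind κ) = ∫ a, ∫ y, g y ∂(κ a) ∂m := by
  have hmeas : ∀ {h : β → ENNReal}, Measurable h → Measurable fun a => ∫⁻ y, h y ∂(κ a) :=
    fun hh => (Measure.measurable_lintegral hh).comp hκ
  have hb : ∀ {h : β → ENNReal}, Measurable h →
      ∫⁻ y, h y ∂(m.bind κ) = ∫⁻ a, ∫⁻ y, h y ∂(κ a) ∂m := fun hh =>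
    Measure.lintegral_bind hκ.aemeasurable hh.aemeasurable
  have hfin := hint.2
  rw [HasFiniteIntegral, hb hg.enorm] at hfin
  have hae : ∀ᵐ a ∂m, Integrable g (κ a) := by
    filter_upwards [ae_lt_top (hmeas hg.enorm) hfin.ne] with a ha
    exact ⟨hg.aestronglyMeasurable, ha⟩
  have hp := hg.ennreal_ofReal
  have hn : Measurable fun y => ENNReal.ofReal (-g y) := hg.neg.ennreal_ofReal
  have hle : ∀ y, ENNReal.ofReal (g y) ≤ ‖g y‖ₑ := fun y => Real.ofReal_le_enorm _
  have hle' : ∀ y, ENNReal.ofReal (-g y) ≤ ‖g y‖ₑ := fun y => by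
    rw [← enorm_neg]; exact Real.ofReal_le_enorm _
  have hpt : ∫⁻ a, ∫⁻ y, ENNReal.ofReal (g y) ∂(κ a) ∂m ≠ ⊤ :=
    ((lintegral_mono fun a => lintegral_mono hle).trans_lt hfin).ne
  have hnt : ∫⁻ a, ∫⁻ y, ENNReal.ofReal (-g y) ∂(κ a) ∂m ≠ ⊤ :=
    ((lintegral_mono fun a => lintegral_mono hle').trans_lt hfin).ne
  have heq : (fun a => ∫ y, g y ∂(κ a)) =ᵐ[m] fun a =>
      (∫⁻ y, ENNReal.ofReal (g y) ∂(κ a)).toReal -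
        (∫⁻ y, ENNReal.ofReal (-g y) ∂(κ a)).toReal := by
    filter_upwards [hae] with a ha
    exact integral_eq_lintegral_pos_part_sub_lintegral_neg_part ha
  have ip := integrable_toReal_of_lintegral_ne_top (hmeas hp).aemeasurable hpt
  have im := integrable_toReal_of_lintegral_ne_top (hmeas hn).aemeasurable hnt
  refine ⟨hae, (ip.sub im).congr heq.symm, ?_⟩
  rw [integral_congr_ae heq, integral_sub ip im,
    integral_toReal (hmeas hp).aemeasurable (ae_lt_top (hmeas hp) hpt),
    integral_toReal (hmeas hn).aemeasurable (ae_lt_top (hmeas hn) hnt), ← hb hp, ← hb hn,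
    integral_eq_lintegral_pos_part_sub_lintegral_neg_part hint]

namespace IsGraphDecomposition

variable {d : ℕ} {T : ℝ} {Ω : ℝ → Set (Space d)} {s : ℕ → Set (Space d)}
  {f : ℕ → Space d → ℝ} {f' : ℕ → Space d → Space d →L[ℝ] ℝ} {v : ℕ → Space d → ℝ}

/-- The union of the graphs of a graph decomposition. -/
def graphs (s : ℕ → Set (Space d)) (f : ℕ → Space d → ℝ) : Set (SpaceTime d) :=
  {p | ∃ i, p.snd ∈ s i ∧ f i p.snd = p.fst}

/-- The surface measure of the graphs at time `t`, as a measure on space-time. -/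
noncomputable def sliceMeasure (s : ℕ → Set (Space d)) (f : ℕ → Space d → ℝ) (t : ℝ) :
    Measure (SpaceTime d) :=
  ((μHE[d - 1] : Measure (Space d)).restrict {x | stPoint t x ∈ graphs s f}).map (stPoint t)

theorem continuous_graphPoint (h : IsGraphDecomposition T Ω s f f' v) (i : ℕ) :
    Continuous fun x => stPoint (f i x) x :=
  continuous_stPoint.comp ((h.continuous i).prodMk continuous_id)

theorem measurableSet_graph (h : IsGraphDecomposition T Ω s f f' v) (i : ℕ) :
    MeasurableSet {p : SpaceTime d | p.snd ∈ s i ∧ f i p.snd = p.fst} := by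
  have h1 : Measurable fun p : SpaceTime d => p.snd :=
    SpaceTime.lipschitzWith_snd.continuous.measurable
  have h2 : Measurable fun p : SpaceTime d => p.fst :=
    SpaceTime.lipschitzWith_fst.continuous.measurable
  exact (h1 (h.measurableSet i)).inter
    (measurableSet_eq_fun ((h.continuous i).measurable.comp h1) h2)

theorem measurableSet_graphs (h : IsGraphDecomposition T Ω s f f' v) :
    MeasurableSet (graphs s f) := by
  have : graphs s f = ⋃ i, {p : SpaceTime d | p.snd ∈ s i ∧ f i p.snd = p.fst} := by
    ext p; simp [graphs]
  rw [this]
  exact MeasurableSet.iUnion h.measurableSet_graph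

theorem ne_zero (h : IsGraphDecomposition T Ω s f f' v) {i : ℕ} {x : Space d} (hx : x ∈ s i) :
    v i x ≠ 0 := fun h0 => by
  have := h.abs_mul_norm i x hx
  simp [h0] at this

theorem fderiv_ne_zero (h : IsGraphDecomposition T Ω s f f' v) {i : ℕ} {x : Space d}
    (hx : x ∈ s i) : f' i x ≠ 0 := fun h0 => by
  have := h.abs_mul_norm i x hx
  simp [h0] at this

theorem enorm_fderiv (h : IsGraphDecomposition T Ω s f f' v) {i : ℕ} {x : Space d}
    (hx : x ∈ s i) : ‖f' i x‖ₑ = ((‖v i x‖₊⁻¹ : ℝ≥0) : ENNReal) := by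
  have := h.abs_mul_norm i x hx
  rw [enorm_eq_nnnorm, ENNReal.coe_inj]
  ext
  push_cast
  exact eq_inv_of_mul_eq_one_right this

theorem coarea (h : IsGraphDecomposition T Ω s f f' v) (i : ℕ) {S : Set (Space d)}
    (hS : MeasurableSet S) :
    Measurable (fun t => μHE[d - 1] (S ∩ s i ∩ f i ⁻¹' {t})) ∧
      ∫⁻ t, μHE[d - 1] (S ∩ s i ∩ f i ⁻¹' {t}) =
        ∫⁻ x in S ∩ s i, ((‖v i x‖₊⁻¹ : ℝ≥0) : ENNReal) := by
  have := measurable_and_lintegral_hausdorff_level (hS.inter (h.measurableSet i))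
    (fun x hx => (h.hasFDerivWithinAt i x hx.2).mono inter_subset_right)
    (fun x hx => h.fderiv_ne_zero hx.2) (h.continuous i).measurable
  rw [finrank_euclideanSpace_fin] at this
  refine ⟨this.1, this.2.trans ?_⟩
  exact setLIntegral_congr_fun (hS.inter (h.measurableSet i)) fun x hx => h.enorm_fderiv hx.2

theorem sliceMeasure_apply (h : IsGraphDecomposition T Ω s f f' v) (t : ℝ)
    {E : Set (SpaceTime d)} (hE : MeasurableSet E) :
    sliceMeasure s f t E =
      ∑' i, μHE[d - 1] ((fun x => stPoint (f i x) x) ⁻¹' E ∩ s i ∩ f i ⁻¹' {t}) := by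
  have hc := (isometry_stPoint (d := d) t).continuous
  rw [sliceMeasure, Measure.map_apply hc.measurable hE,
    Measure.restrict_apply (hc.measurable hE)]
  have : stPoint t ⁻¹' E ∩ {x | stPoint t x ∈ graphs s f} =
      ⋃ i, ((fun x => stPoint (f i x) x) ⁻¹' E ∩ s i ∩ f i ⁻¹' {t}) := by
    ext x
    simp only [graphs, mem_inter_iff, mem_preimage, mem_ofPred_eq, stPoint_snd, stPoint_fst,
      mem_iUnion, mem_singleton_iff]
    constructor
    · rintro ⟨hx, i, hi, hit⟩
      exact ⟨i, ⟨by rwa [hit], hi⟩, hit⟩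
    · rintro ⟨i, ⟨hx, hi⟩, hit⟩
      exact ⟨by rwa [hit] at hx, i, hi, hit⟩
  rw [this]
  refine measure_iUnion (fun i j hij => ?_) fun i =>
    (((h.continuous_graphPoint i).measurable hE).inter (h.measurableSet i)).inter
      ((h.continuous i).measurable (measurableSet_singleton t))
  rw [Function.onFun, disjoint_left]
  rintro x ⟨⟨-, hi⟩, hit⟩ ⟨⟨-, hj⟩, hjt⟩
  exact hij (h.injective i j x hi hj (hit.trans hjt.symm))

theorem measurable_sliceMeasure (h : IsGraphDecomposition T Ω s f f' v) :
    Measurable (sliceMeasure s f) := by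
  refine Measure.measurable_of_measurable_coe _ fun E hE => ?_
  simp only [h.sliceMeasure_apply _ hE]
  exact Measurable.tsum fun i => (h.coarea i ((h.continuous_graphPoint i).measurable hE)).1

/-- The surface measures of the time slices, integrated over time. -/
theorem bind_sliceMeasure (h : IsGraphDecomposition T Ω s f f' v) :
    (volume : Measure ℝ).bind (sliceMeasure s f) = Measure.sum fun i =>
      ((volume.restrict (s i)).withDensity fun x => ((‖v i x‖₊⁻¹ : ℝ≥0) : ENNReal)).map
        fun x => stPoint (f i x) x := by
  refine Measure.ext fun E hE => ?_
  rw [Measure.bind_apply hE h.measurable_sliceMeasure.aemeasurable, Measure.sum_apply _ hE]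
  simp only [h.sliceMeasure_apply _ hE]
  rw [lintegral_tsum fun i =>
    (h.coarea i ((h.continuous_graphPoint i).measurable hE)).1.aemeasurable]
  congr 1
  ext i
  have hEi := (h.continuous_graphPoint i).measurable hE
  rw [(h.coarea i hEi).2, Measure.map_apply (h.continuous_graphPoint i).measurable hE,
    withDensity_apply _ hEi, Measure.restrict_restrict hEi]

theorem tsum_volume_lt_top (h : IsGraphDecomposition T Ω s f f' v)
    (hG : IsLipschitzDomain (spaceTimeDomain T Ω)) : ∑' i, volume (s i) < ⊤ := by
  refine lt_of_le_of_lt ?_ hG.hausdorff_frontier_lt_top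
  have hle : ∀ i, volume (s i) ≤
      μHE[d] {p : SpaceTime d | p.snd ∈ s i ∧ f i p.snd = p.fst} := fun i => by
    refine le_trans (measure_mono ?_) (volume_image_snd_le _)
    exact fun x hx => ⟨stPoint (f i x) x, ⟨hx, rfl⟩, rfl⟩
  refine (ENNReal.tsum_le_tsum hle).trans ?_
  rw [← measure_iUnion (fun i j hij => ?_) h.measurableSet_graph]
  · refine measure_mono (iUnion_subset fun i => ?_)
    rintro p ⟨hp, hpf⟩
    have := (h.mem i _ hp).1
    rwa [hpf] at this
  · rw [Function.onFun, disjoint_left]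
    rintro p ⟨hi, hif⟩ ⟨hj, hjf⟩
    exact hij (h.injective i j _ hi hj (hif.trans hjf.symm))

theorem volume_level_eq_zero (h : IsGraphDecomposition T Ω s f f' v) (i : ℕ) (a : ℝ) :
    volume (s i ∩ f i ⁻¹' {a}) = 0 := by
  have hS : MeasurableSet (f i ⁻¹' {a}) :=
    (h.continuous i).measurable (measurableSet_singleton a)
  have h1 := (h.coarea i hS).2
  have h2 : ∫⁻ t, μHE[d - 1] (f i ⁻¹' {a} ∩ s i ∩ f i ⁻¹' {t}) = 0 := by
    rw [← lintegral_zero (μ := (volume : Measure ℝ))]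
    refine lintegral_congr_ae ?_
    filter_upwards [compl_mem_ae_iff.2 (measure_singleton a)] with t ht
    have : f i ⁻¹' {a} ∩ s i ∩ f i ⁻¹' {t} = ∅ := by
      ext x
      simp only [mem_inter_iff, mem_preimage, mem_singleton_iff, mem_empty_iff_false, iff_false]
      rintro ⟨⟨h3, -⟩, h4⟩
      exact ht (h4.symm.trans h3)
    rw [this, measure_empty]
  rw [h2] at h1
  have hm : Measurable fun x => ((‖v i x‖₊⁻¹ : ℝ≥0) : ENNReal) :=
    (h.measurable i).nnnorm.inv.coe_nnreal_ennreal
  have h3 := (ae_restrict_iff' (hS.inter (h.measurableSet i))).1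
    ((lintegral_eq_zero_iff hm).1 h1.symm)
  refine measure_mono_null (fun x hx => ?_) (ae_iff.1 h3)
  simp only [mem_ofPred_eq, Classical.not_imp]
  refine ⟨⟨hx.2, hx.1⟩, ?_⟩
  simpa using h.ne_zero hx.1

/-- The normal velocity on the graphs. -/
noncomputable def graphVelocity (T : ℝ) (Ω : ℝ → Set (Space d)) (s : ℕ → Set (Space d))
    (f : ℕ → Space d → ℝ) : SpaceTime d → ℝ :=
  (graphs s f).indicator fun p => normalVelocity T Ω p.fst p.snd

theorem graphVelocity_graphPoint (h : IsGraphDecomposition T Ω s f f' v) {i : ℕ} {x : Space d}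
    (hx : x ∈ s i) : graphVelocity T Ω s f (stPoint (f i x) x) = v i x := by
  have hmem : stPoint (f i x) x ∈ graphs s f := ⟨i, hx, rfl⟩
  rw [graphVelocity, indicator_of_mem hmem]
  exact h.velocity i x hx

theorem measurable_graphVelocity (h : IsGraphDecomposition T Ω s f f' v) :
    Measurable (graphVelocity T Ω s f) := by
  intro S hS
  have : graphVelocity T Ω s f ⁻¹' S = ((graphs s f)ᶜ ∩ {_p | (0 : ℝ) ∈ S}) ∪
      ⋃ i, ({p : SpaceTime d | p.snd ∈ s i ∧ f i p.snd = p.fst} ∩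
        (fun p => v i p.snd) ⁻¹' S) := by
    ext p
    by_cases hp : p ∈ graphs s f
    · obtain ⟨i, hi, hif⟩ := id hp
      have hval : graphVelocity T Ω s f p = v i p.snd := by
        have := h.graphVelocity_graphPoint hi
        rwa [hif, stPoint_fst_snd] at this
      simp only [mem_preimage, mem_union, mem_inter_iff, mem_compl_iff, hp, not_true, false_and,
        false_or, mem_iUnion, mem_ofPred_eq]
      constructor
      · exact fun hS => ⟨i, ⟨hi, hif⟩, by rwa [← hval]⟩
      · rintro ⟨j, ⟨hj, hjf⟩, hjS⟩
        rw [h.injective i j _ hi hj (hif.trans hjf.symm)] at hval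
        rwa [hval]
    · have hval : graphVelocity T Ω s f p = 0 := indicator_of_notMem hp _
      have hn : ¬ ∃ i, (p.snd ∈ s i ∧ f i p.snd = p.fst) ∧ v i p.snd ∈ S := fun ⟨i, hi, _⟩ =>
        hp ⟨i, hi⟩
      simp only [mem_preimage, mem_union, mem_inter_iff, mem_compl_iff, hp, not_false_eq_true,
        true_and, mem_iUnion, mem_ofPred_eq, hval, hn, or_false]
  rw [this]
  refine (h.measurableSet_graphs.compl.inter (MeasurableSet.const _)).union
    (MeasurableSet.iUnion fun i => (h.measurableSet_graph i).inter ?_)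
  exact ((h.measurable i).comp SpaceTime.lipschitzWith_snd.continuous.measurable) hS

/-- The integral of a function over the graphs with respect to the signed projected area, summed
along the fibre over `x`: the sum of the values at the crossings of the boundary by the time line,
with the sign of the velocity. -/
noncomputable def crossingSum (s : ℕ → Set (Space d)) (f v : ℕ → Space d → ℝ)
    (k : SpaceTime d → ℝ) (x : Space d) : ℝ :=
  ∑' i, (s i).indicator (fun x => k (stPoint (f i x) x) * (v i x / |v i x|)) x

/-- The integral over time of the integrals of `k` against the normal velocity over the time slices
is the integral over space of the signed sum over the crossings of the time lines. -/
theorem integral_velocity_eq_integral_crossingSum (h : IsGraphDecomposition T Ω s f f' v)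
    (hG : IsLipschitzDomain (spaceTimeDomain T Ω)) {k : SpaceTime d → ℝ} (hk : Measurable k)
    {C : ℝ} (hC : ∀ p, |k p| ≤ C) :
    (∀ᵐ t, Integrable (fun p => k p * graphVelocity T Ω s f p) (sliceMeasure s f t)) ∧
      Integrable (fun t => ∫ p, k p * graphVelocity T Ω s f p ∂(sliceMeasure s f t)) ∧
      Integrable (crossingSum s f v k) ∧
      ∫ t, ∫ p, k p * graphVelocity T Ω s f p ∂(sliceMeasure s f t) =
        ∫ x, crossingSum s f v k x := by
  have hC0 : 0 ≤ C := (abs_nonneg _).trans (hC (stPoint 0 0))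
  set g : SpaceTime d → ℝ := fun p => k p * graphVelocity T Ω s f p with hg
  have hgm : Measurable g := hk.mul h.measurable_graphVelocity
  have hγ := fun i => (h.continuous_graphPoint i).measurable
  have hdm : ∀ i, Measurable fun x => ‖v i x‖₊⁻¹ := fun i => (h.measurable i).nnnorm.inv
  set k' : ℕ → Space d → ℝ := fun i x => k (stPoint (f i x) x) * (v i x / |v i x|) with hk'
  have hk'm : ∀ i, Measurable (k' i) := fun i =>
    (hk.comp (hγ i)).mul ((h.measurable i).div (h.measurable i).norm)
  have hpt : ∀ i, ∀ x ∈ s i, ‖v i x‖₊⁻¹ • g (stPoint (f i x) x) = k' i x := by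
    intro i x hx
    have h0 := abs_pos.2 (h.ne_zero hx)
    simp only [hg, hk', h.graphVelocity_graphPoint hx, NNReal.smul_def, NNReal.coe_inv,
      coe_nnnorm, Real.norm_eq_abs, smul_eq_mul]
    field_simp
  have hk'C : ∀ i x, ‖k' i x‖ₑ ≤ ENNReal.ofReal C := by
    intro i x
    rw [← ofReal_norm]
    refine ENNReal.ofReal_le_ofReal ?_
    rw [hk', norm_mul, norm_div, Real.norm_eq_abs, Real.norm_eq_abs, Real.norm_eq_abs, abs_abs]
    exact (mul_le_of_le_one_right (abs_nonneg _) (div_self_le_one _)).trans (hC _)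
  have hfin : ∑' i, ∫⁻ x in s i, ‖k' i x‖ₑ ≠ ⊤ := by
    refine ne_of_lt (lt_of_le_of_lt (ENNReal.tsum_le_tsum fun i =>
      (lintegral_mono (hk'C i)).trans_eq (setLIntegral_const _ _)) ?_)
    rw [ENNReal.tsum_mul_left]
    exact ENNReal.mul_lt_top ENNReal.ofReal_lt_top (h.tsum_volume_lt_top hG)
  have hint : Integrable g ((volume : Measure ℝ).bind (sliceMeasure s f)) := by
    refine ⟨hgm.aestronglyMeasurable, ?_⟩
    rw [HasFiniteIntegral, h.bind_sliceMeasure, lintegral_sum_measure]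
    refine lt_of_eq_of_lt ?_ hfin.lt_top
    congr 1
    ext i
    rw [lintegral_map hgm.enorm (hγ i), lintegral_withDensity_eq_lintegral_mul _
      (hdm i).coe_nnreal_ennreal (g := fun x => ‖g (stPoint (f i x) x)‖ₑ)
      (hgm.comp (hγ i)).enorm]
    refine setLIntegral_congr_fun (h.measurableSet i) fun x hx => ?_
    simp only [Pi.mul_apply]
    rw [← hpt i x hx, NNReal.smul_def, enorm_smul]
    congr 1
    rw [Real.enorm_of_nonneg (NNReal.coe_nonneg _), ENNReal.ofReal_coe_nnreal]
  obtain ⟨h1, h2, h3⟩ := integral_bind_of_integrable h.measurable_sliceMeasure hgm hint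
  have hindm : ∀ i, AEStronglyMeasurable ((s i).indicator (k' i)) volume := fun i =>
    ((hk'm i).indicator (h.measurableSet i)).aestronglyMeasurable
  have hfin' : ∑' i, ∫⁻ x, ‖(s i).indicator (k' i) x‖ₑ ≠ ⊤ := by
    simp only [enorm_indicator_eq_indicator_enorm]
    simpa only [lintegral_indicator (h.measurableSet _)] using hfin
  refine ⟨h1, h2, ?_, ?_⟩
  · refine ⟨(Measurable.tsum fun i => (hk'm i).indicator (h.measurableSet i)).aestronglyMeasurable,
      ?_⟩
    refine lt_of_le_of_lt (lintegral_mono fun x => enorm_tsum_le_tsum_enorm) ?_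
    rw [lintegral_tsum fun i => (hindm i).enorm]
    exact hfin'.lt_top
  · rw [← h3, h.bind_sliceMeasure, integral_sum_measure (by rwa [← h.bind_sliceMeasure])]
    simp only [crossingSum]
    rw [integral_tsum hindm hfin']
    congr 1
    ext i
    rw [integral_indicator (h.measurableSet i), integral_map (hγ i).aemeasurable
      hgm.aestronglyMeasurable, integral_withDensity_eq_integral_smul (hdm i)]
    exact setIntegral_congr_fun (h.measurableSet i) fun x hx => hpt i x hx

end IsGraphDecomposition

/-! ### The jump measure and increments along time lines -/

theorem ContinuousOn.measurable_indicator_of_measurableSet {X : Type*} [TopologicalSpace X]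
    [MeasurableSpace X] [BorelSpace X] {g : X → ℝ} {S : Set X} (hg : ContinuousOn g S)
    (hS : MeasurableSet S) : Measurable (S.indicator g) := by
  classical
  rw [← piecewise_eq_indicator]
  exact hg.measurable_piecewise continuousOn_const hS

section Jump

variable {d : ℕ} {T : ℝ} {Ω : ℝ → Set (Space d)}

/-- The measure on the time axis that gives to each jump time the volume of the corresponding
jump. -/
noncomputable def jumpMeasure (T : ℝ) (Ω : ℝ → Set (Space d)) : Measure ℝ :=
  Measure.sum fun τ : jumpTimes T Ω =>
    (volume {x | stPoint τ x ∈ frontier (spaceTimeDomain T Ω)}) • Measure.dirac (τ : ℝ)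

/-- The number of jump times in `[a, b]` at which the time line over `x` meets the boundary of the
space-time domain. -/
noncomputable def jumpCount (T : ℝ) (Ω : ℝ → Set (Space d)) (a b : ℝ) (x : Space d) : ENNReal :=
  ∑' τ : jumpTimes T Ω, (Icc a b).indicator 1 (τ : ℝ) *
    {x | stPoint τ x ∈ frontier (spaceTimeDomain T Ω)}.indicator 1 x

theorem isClosed_frontier_slice (t : ℝ) :
    IsClosed {x : Space d | stPoint t x ∈ frontier (spaceTimeDomain T Ω)} :=
  isClosed_frontier.preimage (isometry_stPoint t).continuous

theorem lintegral_jumpCount (hN : (jumpTimes T Ω).Countable) (a b : ℝ) :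
    ∫⁻ x, jumpCount T Ω a b x = jumpMeasure T Ω (Icc a b) := by
  have := hN.to_subtype
  have hm : ∀ τ : jumpTimes T Ω, Measurable
      ({x | stPoint (τ : ℝ) x ∈ frontier (spaceTimeDomain T Ω)}.indicator
        (1 : Space d → ENNReal)) := fun τ =>
    measurable_one.indicator (isClosed_frontier_slice _).measurableSet
  simp only [jumpCount]
  rw [lintegral_tsum fun τ => ((hm τ).const_mul _).aemeasurable, jumpMeasure,
    Measure.sum_apply _ measurableSet_Icc]
  congr 1
  ext τ
  rw [lintegral_const_mul _ (hm τ), lintegral_indicator_one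
    (isClosed_frontier_slice _).measurableSet, Measure.smul_apply,
    Measure.dirac_apply' _ measurableSet_Icc, smul_eq_mul, mul_comm]

/-- The jumps lie on disjoint parts of the boundary, whose total area is finite. -/
theorem tsum_volume_jump_lt_top (hG : IsLipschitzDomain (spaceTimeDomain T Ω)) :
    ∑' τ : jumpTimes T Ω, volume {x | stPoint τ x ∈ frontier (spaceTimeDomain T Ω)} < ⊤ := by
  have := hG.countable_jumpTimes.to_subtype
  refine lt_of_le_of_lt ?_ hG.hausdorff_frontier_lt_top
  have hm : ∀ τ : jumpTimes T Ω, MeasurableSet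
      (frontier (spaceTimeDomain T Ω) ∩ {p : SpaceTime d | p.fst = τ}) := fun τ =>
    isClosed_frontier.measurableSet.inter
      (SpaceTime.lipschitzWith_fst.continuous.measurable (measurableSet_singleton (τ : ℝ)))
  have hle : ∀ τ : jumpTimes T Ω, volume {x | stPoint τ x ∈ frontier (spaceTimeDomain T Ω)} ≤
      μHE[d] (frontier (spaceTimeDomain T Ω) ∩ {p : SpaceTime d | p.fst = τ}) := fun τ =>
    by
      refine le_trans (measure_mono ?_) (volume_image_snd_le _)
      exact fun x hx => ⟨stPoint τ x, ⟨hx, rfl⟩, rfl⟩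
  refine (ENNReal.tsum_le_tsum hle).trans ?_
  rw [← measure_iUnion (fun i j hij => ?_) hm]
  · exact measure_mono (iUnion_subset fun τ => inter_subset_left)
  · rw [Function.onFun, disjoint_left]
    rintro p ⟨-, hi⟩ ⟨-, hj⟩
    exact hij (Subtype.ext (hi.symm.trans hj))

theorem isFiniteMeasure_jumpMeasure (hG : IsLipschitzDomain (spaceTimeDomain T Ω)) :
    IsFiniteMeasure (jumpMeasure T Ω) := by
  refine ⟨?_⟩
  rw [jumpMeasure, Measure.sum_apply _ MeasurableSet.univ]
  simpa using tsum_volume_jump_lt_top hG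

theorem mutuallySingular_jumpMeasure (hN : (jumpTimes T Ω).Countable) :
    jumpMeasure T Ω ⟂ₘ volume := by
  refine ⟨(jumpTimes T Ω)ᶜ, hN.measurableSet.compl, ?_, ?_⟩
  · rw [jumpMeasure, Measure.sum_apply _ hN.measurableSet.compl]
    simp [hN.measurableSet.compl]
  · rw [compl_compl]
    exact hN.measure_zero _

end Jump

section Regularity

variable {d : ℕ} {G : Set (SpaceTime d)} {u : SpaceTime d → ℝ}

theorem hasDerivAt_time (hG : IsOpen G) (hu : ContDiffOn ℝ 1 u G) {t : ℝ} {x : Space d}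
    (hx : stPoint t x ∈ G) :
    HasDerivAt (fun τ => u (stPoint τ x)) (fderiv ℝ u (stPoint t x) (stPoint 1 0)) t := by
  have h1 : HasFDerivAt u (fderiv ℝ u (stPoint t x)) (stPoint t x) :=
    ((hu.differentiableOn one_ne_zero).differentiableAt (hG.mem_nhds hx)).hasFDerivAt
  have h2 : HasDerivAt (fun τ : ℝ => stPoint τ x) (stPoint 1 (0 : Space d)) t := by
    have : (fun τ : ℝ => stPoint τ x) = fun τ => stPoint 0 x + τ • stPoint 1 (0 : Space d) := by
      ext τ : 1
      refine WithLp.ofLp_injective 2 (Prod.ext ?_ ?_) <;> simp [stPoint]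
    rw [this]
    simpa using ((hasDerivAt_id t).smul_const (stPoint 1 (0 : Space d))).const_add (stPoint 0 x)
  exact h1.comp_hasDerivAt t h2

theorem integrable_indicator_stPoint (hb : Bornology.IsBounded G)
    {g : SpaceTime d → ℝ} (hg : Measurable (G.indicator g)) {C : ℝ} (hC : ∀ p ∈ G, |g p| ≤ C) :
    Integrable (fun q : ℝ × Space d => G.indicator g (stPoint q.1 q.2)) ∧
      ∀ t, Integrable fun x => G.indicator g (stPoint t x) := by
  obtain ⟨R, hR⟩ := hb.exists_norm_le
  have hC' : ∀ p, ‖G.indicator g p‖ ≤ max C 0 := fun p => by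
    by_cases hp : p ∈ G
    · rw [indicator_of_mem hp]; exact (hC p hp).trans (le_max_left _ _)
    · rw [indicator_of_notMem hp, norm_zero]; exact le_max_right _ _
  constructor
  · set S : Set (ℝ × Space d) := {q | stPoint q.1 q.2 ∈ G}
    have hsub : S ⊆ Metric.closedBall 0 R := by
      intro q hq
      have h1 := SpaceTime.abs_fst_le (stPoint q.1 q.2)
      have h2 := SpaceTime.norm_snd_le (stPoint q.1 q.2)
      rw [mem_closedBall_zero_iff, Prod.norm_def]
      exact max_le (h1.trans (hR _ hq)) (h2.trans (hR _ hq))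
    have hS : volume S ≠ ⊤ := (Metric.isBounded_closedBall.subset hsub).measure_lt_top.ne
    refine (integrableOn_iff_integrable_of_support_subset (s := S) ?_).1
      (Measure.integrableOn_of_bounded (M := max C 0) hS
        (hg.comp continuous_stPoint.measurable).aestronglyMeasurable
        (Eventually.of_forall fun q => hC' _))
    intro q hq
    by_contra h
    have h' : stPoint q.1 q.2 ∉ G := h
    exact hq (indicator_of_notMem h' _)
  · intro t
    set S : Set (Space d) := {x | stPoint t x ∈ G}
    have hsub : S ⊆ Metric.closedBall 0 R := by
      intro x hx
      have h := SpaceTime.norm_snd_le (stPoint t x)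
      rw [mem_closedBall_zero_iff]
      exact h.trans (hR _ hx)
    have hS : volume S ≠ ⊤ := (Metric.isBounded_closedBall.subset hsub).measure_lt_top.ne
    refine (integrableOn_iff_integrable_of_support_subset (s := S) ?_).1
      (Measure.integrableOn_of_bounded (M := max C 0) hS
        (hg.comp (isometry_stPoint t).continuous.measurable).aestronglyMeasurable
        (Eventually.of_forall fun q => hC' _))
    intro x hx
    by_contra h
    have h' : stPoint t x ∉ G := h
    exact hx (indicator_of_notMem h' _)

end Regularity

section Increment

variable {d : ℕ} {T : ℝ} {Ω : ℝ → Set (Space d)} {s : ℕ → Set (Space d)}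
  {f : ℕ → Space d → ℝ} {f' : ℕ → Space d → Space d →L[ℝ] ℝ} {v : ℕ → Space d → ℝ}
  {u D : SpaceTime d → ℝ}

open IsGraphDecomposition

/-- The increment along almost every time line: the integral of the time derivative plus the
signed values at the crossings of the boundary, up to an error counting the jumps. -/
theorem ae_enorm_increment_sub_le (hΩ : IsMovingDomain T Ω)
    (h : IsGraphDecomposition T Ω s f f' v) {C C₁ : ℝ}
    (hu : ContinuousOn u (closure (spaceTimeDomain T Ω)))
    (hC : ∀ p ∈ closure (spaceTimeDomain T Ω), |u p| ≤ C) (hC0 : 0 ≤ C)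
    (hD : ∀ t x, stPoint t x ∈ spaceTimeDomain T Ω →
      HasDerivAt (fun τ => u (stPoint τ x)) (D (stPoint t x)) t)
    (hDm : Measurable ((spaceTimeDomain T Ω).indicator D))
    (hC₁ : ∀ p ∈ spaceTimeDomain T Ω, |D p| ≤ C₁)
    {a b : ℝ} (ha : 0 < a) (hab : a < b) (hb : b < T) :
    ∀ᵐ x : Space d,
      ‖(spaceTimeDomain T Ω).indicator u (stPoint b x) -
        (spaceTimeDomain T Ω).indicator u (stPoint a x) -
        (∫ τ in a..b, (spaceTimeDomain T Ω).indicator D (stPoint τ x)) -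
        crossingSum s f v ({p | p.fst ∈ Ioo a b}.indicator
          ((closure (spaceTimeDomain T Ω)).indicator u)) x‖ₑ ≤
      ENNReal.ofReal (6 * C) * jumpCount T Ω a b x := by
  classical
  have hG := hΩ.spaceTime
  set G := spaceTimeDomain T Ω with hGdef
  have hNc := hG.countable_jumpTimes
  have := hNc.to_subtype
  have e1 : ∀ᵐ x : Space d, {i | x ∈ s i}.Finite :=
    ae_finite_setOfPred_mem (h.tsum_volume_lt_top hG).ne
  have e2 : ∀ᵐ x : Space d, {τ : jumpTimes T Ω | stPoint (τ : ℝ) x ∈ frontier G}.Finite :=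
    ae_finite_setOfPred_mem (s := fun τ : jumpTimes T Ω => {x | stPoint (τ : ℝ) x ∈ frontier G})
      (tsum_volume_jump_lt_top hG).ne
  have e3 : ∀ᵐ x : Space d, ∀ τ ∈ Ioo 0 T, τ ∉ jumpTimes T Ω → stPoint τ x ∈ frontier G →
      stPoint τ x ∈ graphs s f := by
    have h1 : volume ((fun p : SpaceTime d => p.snd) '' (movingBoundary T Ω \ graphs s f)) = 0 :=
      le_antisymm ((volume_image_snd_le _).trans h.null.le) zero_le
    filter_upwards [compl_mem_ae_iff.2 hΩ.volume_snd_image_not_moving, compl_mem_ae_iff.2 h1]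
      with x hx1 hx2 τ hτ hτN hτG
    by_contra hg
    by_cases hm : stPoint τ x ∈ movingBoundary T Ω
    · exact hx2 ⟨_, ⟨hm, hg⟩, rfl⟩
    · exact hx1 ⟨_, ⟨⟨hτG, hτ, hτN⟩, hm⟩, rfl⟩
  have e4 : ∀ c : ℝ, ∀ᵐ x : Space d, ∀ i, x ∈ s i → f i x ≠ c := fun c => by
    rw [ae_all_iff]
    intro i
    filter_upwards [compl_mem_ae_iff.2 (h.volume_level_eq_zero i c)] with x hx hxi hxc
    exact hx ⟨hxi, hxc⟩
  filter_upwards [e1, e2, e3, e4 a, e4 b] with x hI hN hM hxa hxb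
  have hcont : Continuous fun τ : ℝ => stPoint τ x :=
    continuous_stPoint.comp (by fun_prop : Continuous fun τ : ℝ => (τ, x))
  set O : Set ℝ := (fun τ => stPoint τ x) ⁻¹' G with hO
  have hOo : IsOpen O := hG.isOpen.preimage hcont
  have hOcl : ∀ τ ∈ closure O, stPoint τ x ∈ closure G := fun τ hτ =>
    map_mem_closure (f := fun τ : ℝ => stPoint τ x) hcont hτ fun σ hσ => hσ
  have hOfr : ∀ τ ∈ frontier O, stPoint τ x ∈ frontier G := fun τ hτ => by
    rw [hOo.frontier_eq] at hτ
    rw [hG.isOpen.frontier_eq]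
    exact ⟨hOcl τ hτ.1, hτ.2⟩
  set ZN : Finset ℝ := (hN.image Subtype.val).toFinset with hZN
  set ZB : Finset ℝ := hI.toFinset.image (fun i => f i x) with hZB
  have memN : ∀ τ, τ ∈ ZN ↔ τ ∈ jumpTimes T Ω ∧ stPoint τ x ∈ frontier G := fun τ => by
    simp [hZN, and_comm]
  have memB : ∀ τ, τ ∈ ZB ↔ ∃ i, x ∈ s i ∧ f i x = τ := fun τ => by
    simp [hZB]
  have hNB : Disjoint ZN ZB := by
    rw [Finset.disjoint_left]
    intro τ h1 h2
    obtain ⟨i, hi, rfl⟩ := (memB τ).1 h2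
    exact (h.mem i x hi).2.1.2 ((memN _).1 h1).1
  have hmem : ∀ τ ∈ Icc a b, τ ∈ Ioo 0 T := fun τ hτ => ⟨ha.trans_le hτ.1, hτ.2.trans_lt hb⟩
  have hcover : frontier O ∩ Icc a b ⊆ ZN ∪ ZB := by
    rintro τ ⟨hτ, hτab⟩
    by_cases hτN : τ ∈ jumpTimes T Ω
    · exact Or.inl ((memN τ).2 ⟨hτN, hOfr τ hτ⟩)
    · exact Or.inr ((memB τ).2 (hM τ (hmem τ hτab) hτN (hOfr τ hτ)))
  have hindD : ∀ τ, O.indicator (fun τ => D (stPoint τ x)) τ = G.indicator D (stPoint τ x) :=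
    fun τ => by by_cases hτ : stPoint τ x ∈ G <;> simp [hO, indicator, hτ]
  have hindu : ∀ τ, O.indicator (fun τ => u (stPoint τ x)) τ = G.indicator u (stPoint τ x) :=
    fun τ => by by_cases hτ : stPoint τ x ∈ G <;> simp [hO, indicator, hτ]
  have hint : ∀ a b, IntervalIntegrable (O.indicator fun τ => D (stPoint τ x)) volume a b := by
    intro a b
    rw [intervalIntegrable_iff]
    have hC₁' : ∀ τ, ‖O.indicator (fun τ => D (stPoint τ x)) τ‖ ≤ max C₁ 0 := fun τ => by
      rw [hindD]
      by_cases hp : stPoint τ x ∈ G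
      · rw [indicator_of_mem hp]; exact (hC₁ _ hp).trans (le_max_left _ _)
      · rw [indicator_of_notMem hp, norm_zero]; exact le_max_right _ _
    refine Measure.integrableOn_of_bounded (M := max C₁ 0) (by simp) ?_
      (Eventually.of_forall hC₁')
    rw [show (O.indicator fun τ => D (stPoint τ x)) = fun τ => G.indicator D (stPoint τ x) from
      funext hindD]
    exact (hDm.comp hcont.measurable).aestronglyMeasurable
  -- The jump at a crossing is the value of `u` with the sign of the normal velocity, since the
  -- time line enters the domain where the velocity is positive and leaves it where it is negative.
  set j : ℝ → ℝ := fun τ => u (stPoint τ x) *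
    (normalVelocity T Ω τ x / |normalVelocity T Ω τ x|) with hj
  have hjump : ∀ τ ∈ ZB, τ ∈ Ioo a b → rightValue O (fun τ => u (stPoint τ x)) τ -
      leftValue O (fun τ => u (stPoint τ x)) τ = j τ := by
    intro τ hτ hτab
    obtain ⟨i, hi, rfl⟩ := (memB τ).1 hτ
    have hv0 : normalVelocity T Ω (f i x) x ≠ 0 := (h.mem i x hi).2.2
    have hcr := (isNormalVelocityAt_normalVelocity hv0).eventually_crossing hv0
    have hR : ∀ᶠ τ in 𝓝[>] f i x, f i x < τ := self_mem_nhdsWithin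
    have hL : ∀ᶠ τ in 𝓝[<] f i x, τ < f i x := self_mem_nhdsWithin
    have hcrR := (hcr.filter_mono (nhdsWithin_le_nhds (s := Ioi (f i x)))).and hR
    have hcrL := (hcr.filter_mono (nhdsWithin_le_nhds (s := Iio (f i x)))).and hL
    rcases lt_or_gt_of_ne hv0 with hv | hv
    · have h1 : ∀ᶠ τ in 𝓝[>] f i x, τ ∉ O := hcrR.mono fun τ hτ =>
        hτ.1.2 (mul_neg_of_pos_of_neg (sub_pos.2 hτ.2) hv)
      have h2 : ∀ᶠ τ in 𝓝[<] f i x, τ ∈ O := hcrL.mono fun τ hτ =>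
        hτ.1.1 (mul_pos_of_neg_of_neg (sub_neg.2 hτ.2) hv)
      rw [rightValue_eq_zero_of_eventually_notMem h1, leftValue, if_pos h2]
      simp only [hj, abs_of_neg hv]
      field_simp
      ring
    · have h1 : ∀ᶠ τ in 𝓝[>] f i x, τ ∈ O := hcrR.mono fun τ hτ =>
        hτ.1.1 (mul_pos (sub_pos.2 hτ.2) hv)
      have h2 : ∀ᶠ τ in 𝓝[<] f i x, τ ∉ O := hcrL.mono fun τ hτ =>
        hτ.1.2 (mul_neg_of_neg_of_pos (sub_neg.2 hτ.2) hv)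
      rw [leftValue_eq_zero_of_eventually_notMem h2, rightValue, if_pos h1]
      simp only [hj, abs_of_pos hv]
      field_simp
      ring
  have hmain := abs_increment_sub_le hOo (w := fun τ => u (stPoint τ x))
    (w' := fun τ => D (stPoint τ x)) (hu.comp hcont.continuousOn hOcl)
    (fun τ hτ => hD τ x hτ) hint hC0 (fun τ hτ => hC _ (hOcl τ hτ)) ZN ZB hNB hab hcover
    (fun hmem => by
      obtain ⟨i, hi, hia⟩ := (memB a).1 hmem
      exact hxa i hi hia)
    (fun hmem => by
      obtain ⟨i, hi, hib⟩ := (memB b).1 hmem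
      exact hxb i hi hib) hjump
  have hsum : ∑ τ ∈ ZB with τ ∈ Ioo a b, j τ = crossingSum s f v
      ({p | p.fst ∈ Ioo a b}.indicator ((closure G).indicator u)) x := by
    rw [crossingSum, tsum_eq_sum (s := hI.toFinset) (fun i hi => by
      have hxi : x ∉ s i := fun hxi => hi (hI.mem_toFinset.2 hxi)
      exact indicator_of_notMem hxi _), Finset.sum_filter, hZB, Finset.sum_image]
    · refine Finset.sum_congr rfl fun i hi => ?_
      have hxi : x ∈ s i := hI.mem_toFinset.1 hi
      have hcl : stPoint (f i x) x ∈ closure G := frontier_subset_closure (h.mem i x hxi).1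
      rw [indicator_of_mem hxi]
      split_ifs with hio
      · rw [indicator_of_mem (by exact hio), indicator_of_mem hcl]
        simp only [hj, h.velocity i x hxi]
      · rw [indicator_of_notMem (by exact hio), zero_mul]
    · intro i hi i' hi' hii'
      exact h.injective i i' x (hI.mem_toFinset.1 hi) (hI.mem_toFinset.1 hi') hii'
  rw [hsum] at hmain
  simp only [hindu, hindD] at hmain
  have hcount : ((ZN.filter (· ∈ Icc a b)).card : ENNReal) ≤ jumpCount T Ω a b x := by
    have hsub : ∀ τ ∈ ZN.filter (· ∈ Icc a b), τ ∈ jumpTimes T Ω := fun τ hτ =>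
      ((memN τ).1 (Finset.mem_filter.1 hτ).1).1
    rw [jumpCount, Finset.card_eq_sum_ones, Nat.cast_sum,
      ← Finset.sum_subtype_of_mem (p := (· ∈ jumpTimes T Ω)) _ hsub]
    refine le_trans (Finset.sum_le_sum fun τ hτ => ?_) (ENNReal.sum_le_tsum _)
    have h1 := Finset.mem_filter.1 (Finset.mem_subtype.1 hτ)
    rw [indicator_of_mem h1.2, indicator_of_mem (by exact ((memN _).1 h1.1).2)]
    simp
  rw [← ofReal_norm, Real.norm_eq_abs]
  refine (ENNReal.ofReal_le_ofReal hmain).trans ?_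
  rw [ENNReal.ofReal_mul (by positivity), ENNReal.ofReal_natCast]
  gcongr

end Increment

/-! ### Differentiation in time -/

/-- A function whose increments agree with those of an indefinite integral up to a singular measure
of the interval is differentiable almost everywhere. -/
theorem ae_hasDerivAt_of_abs_increment_sub_le {F φ : ℝ → ℝ} {ν : Measure ℝ} [IsFiniteMeasure ν]
    (hν : ν ⟂ₘ volume) (hφ : Integrable φ) {K T : ℝ} (hK : 0 ≤ K)
    (hF : ∀ a b, 0 < a → a < b → b < T →
      |F b - F a - ∫ τ in a..b, φ τ| ≤ K * ν.real (Icc a b)) :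
    ∀ᵐ t, t ∈ Ioo 0 T → HasDerivAt F (φ t) t := by
  filter_upwards [LocallyIntegrable.ae_hasDerivAt_integral hφ.locallyIntegrable,
    Besicovitch.ae_tendsto_rnDeriv ν volume, hν.rnDeriv_ae_eq_zero] with t h1 h2 h3 ht
  rw [h3, Pi.zero_apply] at h2
  have hii : ∀ a b, IntervalIntegrable φ volume a b := fun a b => hφ.intervalIntegrable
  suffices h : HasDerivAt (fun s => F s - ∫ τ in (0 : ℝ)..s, φ τ) 0 t by
    have h5 := h.add (h1 0)
    rw [zero_add] at h5
    exact h5.congr_of_eventuallyEq (Eventually.of_forall fun s => (sub_add_cancel _ _).symm)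
  rw [hasDerivAt_iff_isLittleO, Asymptotics.isLittleO_iff]
  intro c hc
  have hc' : 0 < c / (2 * (K + 1)) := by positivity
  have h4 := h2.eventually (gt_mem_nhds (ENNReal.ofReal_pos.2 hc'))
  obtain ⟨ε, hε, hsub⟩ := mem_nhdsGT_iff_exists_Ioo_subset.1 h4
  have hball : ∀ r ∈ Ioo 0 ε, K * ν.real (Metric.closedBall t r) ≤ c * r := by
    intro r hr
    have h5 : ν (Metric.closedBall t r) / volume (Metric.closedBall t r) <
      ENNReal.ofReal (c / (2 * (K + 1))) := hsub hr
    have hr0 : 0 < r := hr.1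
    rw [Real.volume_closedBall, ENNReal.div_lt_iff (Or.inl (by simpa using hr0))
      (Or.inl ENNReal.ofReal_ne_top), ← ENNReal.ofReal_mul hc'.le] at h5
    have h6 : ν.real (Metric.closedBall t r) ≤ c / (2 * (K + 1)) * (2 * r) :=
      ENNReal.toReal_le_of_le_ofReal (by positivity) h5.le
    calc K * ν.real (Metric.closedBall t r) ≤ (K + 1) * (c / (2 * (K + 1)) * (2 * r)) := by
          gcongr; linarith
      _ = c * r := by field_simp
  have hinc : ∀ a b, 0 < a → a < b → b < T →
      |(F b - ∫ τ in (0 : ℝ)..b, φ τ) - (F a - ∫ τ in (0 : ℝ)..a, φ τ)| ≤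
        K * ν.real (Icc a b) := by
    intro a b ha hab hb
    have h5 := intervalIntegral.integral_add_adjacent_intervals (hii 0 a) (hii a b)
    refine le_trans (le_of_eq ?_) (hF a b ha hab hb)
    rw [← h5]
    congr 1
    ring
  filter_upwards [Ioo_mem_nhds ht.1 ht.2, Metric.ball_mem_nhds t hε] with r hr hrε
  rw [smul_zero, sub_zero, Real.norm_eq_abs, Real.norm_eq_abs]
  rw [Metric.mem_ball, Real.dist_eq] at hrε
  rcases lt_trichotomy r t with h | h | h
  · rw [abs_sub_comm]
    refine (hinc r t hr.1 h ht.2).trans (le_trans ?_ (hball _ ⟨abs_pos.2 (sub_ne_zero.2 h.ne), hrε⟩))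
    refine mul_le_mul_of_nonneg_left (measureReal_mono fun y hy => ?_) hK
    rw [Metric.mem_closedBall, Real.dist_eq, abs_of_neg (sub_neg.2 h), abs_le]
    constructor <;> linarith [hy.1, hy.2]
  · simp [h]
  · refine (hinc t r ht.1 h hr.2).trans (le_trans ?_ (hball _ ⟨abs_pos.2 (sub_ne_zero.2 h.ne'), hrε⟩))
    refine mul_le_mul_of_nonneg_left (measureReal_mono fun y hy => ?_) hK
    rw [Metric.mem_closedBall, Real.dist_eq, abs_of_pos (sub_pos.2 h), abs_le]
    constructor <;> linarith [hy.1, hy.2]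

section Increment

variable {d : ℕ} {T : ℝ} {Ω : ℝ → Set (Space d)} {s : ℕ → Set (Space d)}
  {f : ℕ → Space d → ℝ} {f' : ℕ → Space d → Space d →L[ℝ] ℝ} {v : ℕ → Space d → ℝ}
  {u D : SpaceTime d → ℝ}

open IsGraphDecomposition

theorem ae_sliceMeasure_fst_eq (s : ℕ → Set (Space d)) (f : ℕ → Space d → ℝ) (t : ℝ) :
    ∀ᵐ p ∂(sliceMeasure s f t), p.fst = t := by
  have hm : MeasurableSet {p : SpaceTime d | p.fst = t} :=
    SpaceTime.lipschitzWith_fst.continuous.measurable (measurableSet_singleton t)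
  exact (ae_map_iff (isometry_stPoint t).continuous.aemeasurable hm).2
    (Eventually.of_forall fun x => rfl)

theorem abs_indicator_le {X : Type*} {S : Set X} {g : X → ℝ} {C : ℝ} (hC0 : 0 ≤ C)
    (hC : ∀ p ∈ S, |g p| ≤ C) (p : X) : |S.indicator g p| ≤ C := by
  by_cases hp : p ∈ S
  · rw [indicator_of_mem hp]; exact hC p hp
  · rw [indicator_of_notMem hp, abs_zero]; exact hC0

/-- The increment of the integral over the moving domain is the integral over time of the integral
of the time derivative and of the boundary term, up to an error controlled by the jumps. -/
theorem abs_integral_increment_sub_le (hΩ : IsMovingDomain T Ω)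
    (h : IsGraphDecomposition T Ω s f f' v) {C C₁ : ℝ}
    (hu : ContinuousOn u (closure (spaceTimeDomain T Ω)))
    (hC : ∀ p ∈ closure (spaceTimeDomain T Ω), |u p| ≤ C) (hC0 : 0 ≤ C)
    (hD : ∀ t x, stPoint t x ∈ spaceTimeDomain T Ω →
      HasDerivAt (fun τ => u (stPoint τ x)) (D (stPoint t x)) t)
    (hDm : Measurable ((spaceTimeDomain T Ω).indicator D))
    (hC₁ : ∀ p ∈ spaceTimeDomain T Ω, |D p| ≤ C₁)
    {a b : ℝ} (ha : 0 < a) (hab : a < b) (hb : b < T) :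
    |(∫ x, (spaceTimeDomain T Ω).indicator u (stPoint b x)) -
        (∫ x, (spaceTimeDomain T Ω).indicator u (stPoint a x)) -
        ∫ τ in a..b, ((∫ x, (spaceTimeDomain T Ω).indicator D (stPoint τ x)) +
          ∫ p, (closure (spaceTimeDomain T Ω)).indicator u p * graphVelocity T Ω s f p
            ∂(sliceMeasure s f τ))| ≤
      6 * C * (jumpMeasure T Ω).real (Icc a b) := by
  have hae := ae_enorm_increment_sub_le hΩ h hu hC hC0 hD hDm hC₁ ha hab hb
  have hG := hΩ.spaceTime
  set G := spaceTimeDomain T Ω with hGdef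
  have := isFiniteMeasure_jumpMeasure hG
  set k := (closure G).indicator u with hk
  set k' := ({p | p.fst ∈ Ioo a b} : Set (SpaceTime d)).indicator k with hk'
  have hum : Measurable (G.indicator u) :=
    (hu.mono subset_closure).measurable_indicator_of_measurableSet hG.isOpen.measurableSet
  have hkm : Measurable k :=
    hu.measurable_indicator_of_measurableSet isClosed_closure.measurableSet
  have hkC : ∀ p, |k p| ≤ C := abs_indicator_le hC0 hC
  have hIm : MeasurableSet ({p | p.fst ∈ Ioo a b} : Set (SpaceTime d)) :=
    SpaceTime.lipschitzWith_fst.continuous.measurable measurableSet_Ioo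
  have hk'm : Measurable k' := hkm.indicator hIm
  have hk'C : ∀ p, |k' p| ≤ C := abs_indicator_le hC0 fun p _ => hkC p
  have hui := (integrable_indicator_stPoint hG.isBounded hum
    fun p hp => hC p (subset_closure hp)).2
  obtain ⟨hDi, hDt⟩ := integrable_indicator_stPoint hG.isBounded hDm hC₁
  obtain ⟨-, hβ, -, -⟩ := h.integral_velocity_eq_integral_crossingSum hG hkm hkC
  obtain ⟨-, -, hcs, hcse⟩ := h.integral_velocity_eq_integral_crossingSum hG hk'm hk'C
  have hα : Integrable fun t => ∫ x, G.indicator D (stPoint t x) := hDi.integral_prod_left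
  -- Fubini for the time derivative
  have hDab : Integrable (fun q : Space d × ℝ => G.indicator D (stPoint q.2 q.1))
      ((volume : Measure (Space d)).prod (volume.restrict (Ioc a b))) := by
    have : Integrable (fun q : Space d × ℝ => G.indicator D (stPoint q.2 q.1))
      ((volume : Measure (Space d)).prod volume) := hDi.swap
    exact this.mono_measure (Measure.prod_mono le_rfl Measure.restrict_le_self)
  have hfub : ∫ x, ∫ τ in a..b, G.indicator D (stPoint τ x) =
      ∫ τ in a..b, ∫ x, G.indicator D (stPoint τ x) := by
    simp only [intervalIntegral.integral_of_le hab.le]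
    exact integral_integral_swap (f := fun x τ => G.indicator D (stPoint τ x)) hDab
  have hDx : Integrable fun x => ∫ τ in a..b, G.indicator D (stPoint τ x) := by
    simp only [intervalIntegral.integral_of_le hab.le]
    exact hDab.integral_prod_left
  -- localization of the boundary term to the time interval
  have hloc : ∫ t, ∫ p, k' p * graphVelocity T Ω s f p ∂(sliceMeasure s f t) =
      ∫ τ in a..b, ∫ p, k p * graphVelocity T Ω s f p ∂(sliceMeasure s f τ) := by
    rw [intervalIntegral.integral_of_le hab.le, integral_Ioc_eq_integral_Ioo,
      ← integral_indicator measurableSet_Ioo]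
    congr 1
    ext t
    by_cases ht : t ∈ Ioo a b
    · rw [indicator_of_mem ht]
      refine integral_congr_ae ?_
      filter_upwards [ae_sliceMeasure_fst_eq s f t] with p hp
      have hp' : p ∈ {p : SpaceTime d | p.fst ∈ Ioo a b} := by rw [← hp] at ht; exact ht
      rw [hk', indicator_of_mem hp']
    · rw [indicator_of_notMem ht]
      refine integral_eq_zero_of_ae ?_
      filter_upwards [ae_sliceMeasure_fst_eq s f t] with p hp
      have hp' : p ∉ {p : SpaceTime d | p.fst ∈ Ioo a b} := by rw [← hp] at ht; exact ht
      rw [hk', indicator_of_notMem hp', zero_mul, Pi.zero_apply]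
  have heq : (∫ x, G.indicator u (stPoint b x)) - (∫ x, G.indicator u (stPoint a x)) -
      (∫ τ in a..b, ((∫ x, G.indicator D (stPoint τ x)) +
          ∫ p, k p * graphVelocity T Ω s f p ∂(sliceMeasure s f τ))) =
      ∫ x, (G.indicator u (stPoint b x) - G.indicator u (stPoint a x) -
        (∫ τ in a..b, G.indicator D (stPoint τ x)) - crossingSum s f v k' x) := by
    have hi1 : Integrable fun x => G.indicator u (stPoint b x) - G.indicator u (stPoint a x) :=
      (hui b).sub (hui a)
    have hi2 : Integrable fun x => G.indicator u (stPoint b x) - G.indicator u (stPoint a x) -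
        ∫ τ in a..b, G.indicator D (stPoint τ x) := hi1.sub hDx
    rw [integral_sub hi2 hcs, integral_sub hi1 hDx, integral_sub (hui b) (hui a), ← hcse, hloc, hfub,
      intervalIntegral.integral_add hα.intervalIntegrable hβ.intervalIntegrable]
    ring
  rw [heq, ← Real.norm_eq_abs, ← toReal_enorm]
  have hle := (enorm_integral_le_lintegral_enorm _).trans (lintegral_mono_ae hae)
  have hlin : ∫⁻ x, ENNReal.ofReal (6 * C) * jumpCount T Ω a b x =
      ENNReal.ofReal (6 * C) * jumpMeasure T Ω (Icc a b) := by
    rw [lintegral_const_mul' _ _ ENNReal.ofReal_ne_top,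
      lintegral_jumpCount hG.countable_jumpTimes]
  rw [hlin] at hle
  refine (ENNReal.toReal_mono (ENNReal.mul_ne_top ENNReal.ofReal_ne_top (measure_ne_top _ _))
    hle).trans_eq ?_
  rw [ENNReal.toReal_mul, ENNReal.toReal_ofReal (by positivity), measureReal_def]

/-- At almost every time, the surface integral against the normal velocity is the integral against
the surface measure of the graphs. -/
theorem ae_integral_normalVelocity_eq (hd : 1 ≤ d) (hΩ : IsMovingDomain T Ω)
    (h : IsGraphDecomposition T Ω s f f' v) {C : ℝ}
    (hu : ContinuousOn u (closure (spaceTimeDomain T Ω)))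
    (hC : ∀ p ∈ closure (spaceTimeDomain T Ω), |u p| ≤ C) (hC0 : 0 ≤ C) :
    ∀ᵐ t, t ∈ Ioo 0 T →
      IntegrableOn (fun x => u (stPoint t x) * normalVelocity T Ω t x) (frontier (Ω t))
        μHE[d - 1] ∧
      ∫ x in frontier (Ω t), u (stPoint t x) * normalVelocity T Ω t x ∂μHE[d - 1] =
        ∫ p, (closure (spaceTimeDomain T Ω)).indicator u p * graphVelocity T Ω s f p
            ∂(sliceMeasure s f t) := by
  have hG := hΩ.spaceTime
  have hkm : Measurable ((closure (spaceTimeDomain T Ω)).indicator u) :=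
    hu.measurable_indicator_of_measurableSet isClosed_closure.measurableSet
  have hint := (h.integral_velocity_eq_integral_crossingSum hG hkm (abs_indicator_le hC0 hC)).1
  filter_upwards [hint, ae_hausdorff_slice_eq_zero hd h.null,
    compl_mem_ae_iff.2 (hG.countable_jumpTimes.measure_zero volume)] with t h1 h2 h3 ht
  set G := spaceTimeDomain T Ω with hGdef
  set A : Set (Space d) := {x | stPoint t x ∈ graphs s f} with hA
  have hcont := (isometry_stPoint (d := d) t).continuous
  have hAm : MeasurableSet A := hcont.measurable h.measurableSet_graphs
  have hgm : Measurable fun p => (closure G).indicator u p * graphVelocity T Ω s f p :=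
    hkm.mul h.measurable_graphVelocity
  set g : Space d → ℝ := fun x => (closure G).indicator u (stPoint t x) *
    graphVelocity T Ω s f (stPoint t x) with hg
  rw [sliceMeasure, integrable_map_measure hgm.aestronglyMeasurable hcont.aemeasurable] at h1
  have hAfr : A ⊆ frontier (Ω t) := by
    rintro x ⟨i, hi, hif⟩
    have hm := h.mem i x hi
    have hif' : f i x = t := hif
    rw [hif'] at hm
    by_contra hx
    exact h3 ⟨ht, x, hm.1, hx⟩
  have hgA : A.indicator g = g := by
    refine indicator_eq_self.2 fun x hx => ?_
    by_contra hxA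
    have hxA' : stPoint t x ∉ graphs s f := hxA
    exact hx (by simp only [hg, graphVelocity, indicator_of_notMem hxA', mul_zero])
  have hgi : Integrable g μHE[d - 1] := by
    rw [← hgA, integrable_indicator_iff hAm]
    exact h1
  have hae : ∀ᵐ x ∂(μHE[d - 1] : Measure (Space d)), x ∈ frontier (Ω t) →
      u (stPoint t x) * normalVelocity T Ω t x = g x := by
    filter_upwards [compl_mem_ae_iff.2 h2] with x hx hxf
    have hxG : stPoint t x ∈ frontier G := stPoint_mem_frontier hG.isOpen ht hxf
    simp only [hg]
    rw [indicator_of_mem (frontier_subset_closure hxG)]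
    congr 1
    by_cases hxA : stPoint t x ∈ graphs s f
    · rw [graphVelocity, indicator_of_mem hxA]
      rfl
    · rw [graphVelocity, indicator_of_notMem hxA]
      by_contra h0
      exact hx ⟨⟨hxG, ⟨ht, h3⟩, h0⟩, hxA⟩
  have hfm : MeasurableSet (frontier (Ω t)) := isClosed_frontier.measurableSet
  have hae' := (ae_restrict_iff' hfm).2 hae
  refine ⟨hgi.integrableOn.congr_fun_ae (hae'.mono fun x hx => hx.symm), ?_⟩
  rw [integral_congr_ae hae', sliceMeasure, integral_map hcont.aemeasurable
    hgm.aestronglyMeasurable]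
  change ∫ x in frontier (Ω t), g x ∂μHE[d - 1] = ∫ x in A, g x ∂μHE[d - 1]
  rw [← hgA, setIntegral_indicator hAm, inter_eq_self_of_subset_right hAfr,
    setIntegral_indicator hAm, inter_self]

end Increment

theorem mainTheorem9 {d : ℕ} (hd : 1 ≤ d) {T : ℝ} (hT : 0 < T) (Ω : ℝ → Set (Space d))
    (hΩ : IsMovingDomain T Ω) (u : SpaceTime d → ℝ)
    (hu : IsC1UpToBoundary (spaceTimeDomain T Ω) u) :
    ∀ᵐ t ∂(volume.restrict (Ioo 0 T)),
      IntegrableOn (fun x => u (stPoint t x)) (Ω t) volume ∧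
      IntegrableOn (fun x => deriv (fun s => u (stPoint s x)) t) (Ω t) volume ∧
      IntegrableOn (fun x => u (stPoint t x) * normalVelocity T Ω t x) (frontier (Ω t))
        (Measure.euclideanHausdorffMeasure (d - 1)) ∧
      HasDerivAt (fun s => ∫ x in Ω s, u (stPoint s x))
        ((∫ x in Ω t, deriv (fun s => u (stPoint s x)) t) +
          ∫ x in frontier (Ω t), u (stPoint t x) * normalVelocity T Ω t x
            ∂(Measure.euclideanHausdorffMeasure (d - 1))) t := by
  have hG := hΩ.spaceTime
  obtain ⟨hu1, huc, D₀, hDc, hDf⟩ := hu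
  obtain ⟨s, f, f', v, h⟩ := hΩ.exists_isGraphDecomposition
  set G := spaceTimeDomain T Ω with hGdef
  have hcpt : IsCompact (closure G) := hG.isBounded.isCompact_closure
  set D : SpaceTime d → ℝ := fun p => D₀ p (stPoint 1 0) with hDdef
  have hDcont : ContinuousOn D (closure G) := hDc.clm_apply continuousOn_const
  obtain ⟨C', hC'⟩ := hcpt.exists_bound_of_continuousOn huc
  obtain ⟨C₁, hC₁'⟩ := hcpt.exists_bound_of_continuousOn hDcont
  have hC : ∀ p ∈ closure G, |u p| ≤ max C' 0 := fun p hp => (hC' p hp).trans (le_max_left _ _)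
  have hC0 : 0 ≤ max C' 0 := le_max_right _ _
  have hC₁ : ∀ p ∈ G, |D p| ≤ C₁ := fun p hp => hC₁' p (subset_closure hp)
  have hD : ∀ t x, stPoint t x ∈ G → HasDerivAt (fun τ => u (stPoint τ x)) (D (stPoint t x)) t :=
    fun t x hx => by
      have := hasDerivAt_time hG.isOpen hu1 hx
      rwa [← hDf _ hx] at this
  have hDm : Measurable (G.indicator D) := (hDcont.mono
    subset_closure).measurable_indicator_of_measurableSet hG.isOpen.measurableSet
  have hum : Measurable (G.indicator u) :=
    (huc.mono subset_closure).measurable_indicator_of_measurableSet hG.isOpen.measurableSet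
  have hui := (integrable_indicator_stPoint hG.isBounded hum
    fun p hp => hC p (subset_closure hp)).2
  obtain ⟨hDi, hDt⟩ := integrable_indicator_stPoint hG.isBounded hDm hC₁
  have hkm : Measurable ((closure G).indicator u) :=
    huc.measurable_indicator_of_measurableSet isClosed_closure.measurableSet
  have hβ := (h.integral_velocity_eq_integral_crossingSum hG hkm (abs_indicator_le hC0 hC)).2.1
  have hα : Integrable fun t => ∫ x, G.indicator D (stPoint t x) := hDi.integral_prod_left
  have := isFiniteMeasure_jumpMeasure hG
  have hder := ae_hasDerivAt_of_abs_increment_sub_le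
    (mutuallySingular_jumpMeasure hG.countable_jumpTimes) (hα.add hβ) (by positivity)
    fun a b ha hab hb => abs_integral_increment_sub_le hΩ h huc hC hC0 hD hDm hC₁ ha hab hb
  have hslice : ∀ t ∈ Ioo 0 T, ∀ g : SpaceTime d → ℝ,
      (fun x => G.indicator g (stPoint t x)) = (Ω t).indicator fun x => g (stPoint t x) := by
    intro t ht g
    ext x
    have hiff : stPoint t x ∈ G ↔ x ∈ Ω t := ⟨fun hx => hx.2, fun hx => ⟨ht, hx⟩⟩
    by_cases hx : x ∈ Ω t
    · rw [indicator_of_mem hx, indicator_of_mem (hiff.2 hx)]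
    · rw [indicator_of_notMem hx, indicator_of_notMem fun hx' => hx (hiff.1 hx')]
  rw [ae_restrict_iff' measurableSet_Ioo]
  filter_upwards [hder, ae_integral_normalVelocity_eq hd hΩ h huc hC hC0] with t h1 h2 ht
  obtain ⟨h3, h4⟩ := h2 ht
  have hΩm : ∀ s ∈ Ioo 0 T, MeasurableSet (Ω s) := fun s hs =>
    (hΩ.slice s hs).isOpen.measurableSet
  have hDΩ : EqOn (fun x => deriv (fun s => u (stPoint s x)) t) (fun x => D (stPoint t x))
      (Ω t) := fun x hx => (hD t x ⟨ht, hx⟩).deriv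
  refine ⟨?_, ?_, h3, ?_⟩
  · rw [← integrable_indicator_iff (hΩm t ht), ← hslice t ht]
    exact hui t
  · refine IntegrableOn.congr_fun ?_ hDΩ.symm (hΩm t ht)
    rw [← integrable_indicator_iff (hΩm t ht), ← hslice t ht]
    exact hDt t
  · rw [h4, setIntegral_congr_fun (hΩm t ht) hDΩ, ← integral_indicator (hΩm t ht), ← hslice t ht]
    refine (h1 ht).congr_of_eventuallyEq ?_
    filter_upwards [Ioo_mem_nhds ht.1 ht.2] with r hr
    rw [← integral_indicator (hΩm r hr), ← hslice r hr]
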